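/- **Theorem.** All graphs are finite, simple and undirected. A proper coloring $V_1\uplus\cdots\uplus V_k$ of a graph $H$ is a *partial Grundy coloring of order $k$* if for every $i\in[k]$ there is $v_i\in V_i$ that has a neighbor in $V_j$ for every $j<i$; it is a *$b$-coloring of order $k$* if for every $i\in[k]$ there is $v_i\in V_i$ that has a neighbor in $V_j$ for every $j\neq i$. Given a graph $G$ and an integer $k>0$, the problem *Partial Grundy Coloring* (respectively *$b$-Chromatic Core*) asks whether there is a set $S\subseteq V(G)$ such that the induced subgraph $G[S]$ admits a partial Grundy coloring (respectively a $b$-coloring) of order $k$. For each of the two problems, *$b$-Chromatic Core* and *Partial Grundy Coloring*, there are a function $h:\mathbb N\times\mathbb N\to\mathbb N$, a constant $c$ and a single deterministic algorithm (on a random access machine with addition and subtraction at unit cost) which, given integers $k>0$ and $t$ and a graph $G$ on $n$ vertices, presented by its adjacency matrix, that does not contain $K_{t,t}$ as a (not necessarily induced) subgraph, decides in time at most $h(k,t)\cdot \max(n,1)^{c}$ whether $(G,k)$ is a yes-instance of the problem. That is, both problems are solvable in time $h(k,t)\cdot n^{O(1)}$ on $K_{t,t}$-free graphs. -/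

import Mathlib

/-! ### Partial Grundy colorings, b-colorings and the two decision problems -/

section Colorings

variable {V : Type*}

/-- A proper coloring of `G` with colors `0, …, k - 1` is a partial Grundy coloring of order `k` if
every color class `i` contains a vertex having a neighbor in each class `j < i`. -/
def IsPartialGrundyColoring (G : SimpleGraph V) (k : ℕ) (C : G.Coloring (Fin k)) : Prop :=
  ∀ i : Fin k, ∃ v : V, C v = i ∧ ∀ j : Fin k, j < i → ∃ u : V, G.Adj v u ∧ C u = j

/-- A proper coloring of `G` with `k` colors is a b-coloring of order `k` if every color class `i`
contains a vertex having a neighbor in each class `j ≠ i`. -/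
def IsBColoring (G : SimpleGraph V) (k : ℕ) (C : G.Coloring (Fin k)) : Prop :=
  ∀ i : Fin k, ∃ v : V, C v = i ∧ ∀ j : Fin k, j ≠ i → ∃ u : V, G.Adj v u ∧ C u = j

/-- The question of Partial Grundy Coloring on the instance `(G, k)`. -/
def PartialGrundyColoringProblem (G : SimpleGraph V) (k : ℕ) : Prop :=
  ∃ (S : Set V) (C : (G.induce S).Coloring (Fin k)), IsPartialGrundyColoring (G.induce S) k C

/-- The question of b-Chromatic Core on the instance `(G, k)`. -/
def BChromaticCoreProblem (G : SimpleGraph V) (k : ℕ) : Prop :=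
  ∃ (S : Set V) (C : (G.induce S).Coloring (Fin k)), IsBColoring (G.induce S) k C

end Colorings

/-! ### Random access machines

Programs are finite texts. They work on registers and on arrays (both named by literals of the
program text) that hold natural numbers; array cells are addressed indirectly. The only arithmetic
operations are addition and truncated subtraction, and the running time is the number of elementary
operations (unit cost). Without multiplication, this cost measure is polynomially related to the
running time of Turing machines. -/

namespace RAM

/-- Arithmetic expressions: literals, registers, sums, truncated differences, array look-ups. -/
inductive Expr : Type
  | const (c : ℕ) : Expr
  | reg (x : ℕ) : Expr
  | add (e₁ e₂ : Expr) : Expr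
  | sub (e₁ e₂ : Expr) : Expr
  | load (a : ℕ) (e : Expr) : Expr

/-- Programs. A test `e` succeeds if the value of `e` is nonzero. -/
inductive Prog : Type
  | skip : Prog
  | assign (x : ℕ) (e : Expr) : Prog
  | store (a : ℕ) (e₁ e₂ : Expr) : Prog
  | seq (p q : Prog) : Prog
  | branch (e : Expr) (p q : Prog) : Prog
  | loop (e : Expr) (p : Prog) : Prog

/-- A machine state: `regs x` is the content of register `x`, and `arrs a i` is the content of
cell `i` of array `a`. -/
structure State : Type where
  regs : ℕ → ℕ
  arrs : ℕ → ℕ → ℕ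

/-- The value of an expression. -/
def Expr.eval (s : State) : Expr → ℕ
  | .const c => c
  | .reg x => s.regs x
  | .add e₁ e₂ => e₁.eval s + e₂.eval s
  | .sub e₁ e₂ => e₁.eval s - e₂.eval s
  | .load a e => s.arrs a (e.eval s)

/-- The number of elementary operations needed to evaluate an expression. -/
def Expr.cost : Expr → ℕ
  | .const _ => 1
  | .reg _ => 1
  | .add e₁ e₂ => e₁.cost + e₂.cost + 1
  | .sub e₁ e₂ => e₁.cost + e₂.cost + 1
  | .load _ e => e.cost + 1

/-- Write the value `v` into register `x`. -/
def State.setReg (s : State) (x v : ℕ) : State :=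
  { s with regs := Function.update s.regs x v }

/-- Write the value `v` into cell `i` of array `a`. -/
def State.setArr (s : State) (a i v : ℕ) : State :=
  { s with arrs := Function.update s.arrs a (Function.update (s.arrs a) i v) }

/-- `Exec p s s' T`: started in state `s`, the program `p` halts in state `s'` after exactly `T`
elementary steps. -/
inductive Exec : Prog → State → State → ℕ → Prop
  | skip (s : State) : Exec .skip s s 1
  | assign (s : State) (x : ℕ) (e : Expr) :
      Exec (.assign x e) s (s.setReg x (e.eval s)) (e.cost + 1)
  | store (s : State) (a : ℕ) (e₁ e₂ : Expr) :
      Exec (.store a e₁ e₂) s (s.setArr a (e₁.eval s) (e₂.eval s)) (e₁.cost + e₂.cost + 1)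
  | seq {p q : Prog} {s₁ s₂ s₃ : State} {T₁ T₂ : ℕ} (hp : Exec p s₁ s₂ T₁)
      (hq : Exec q s₂ s₃ T₂) : Exec (.seq p q) s₁ s₃ (T₁ + T₂)
  | branchTrue {e : Expr} {p q : Prog} {s s' : State} {T : ℕ} (he : e.eval s ≠ 0)
      (hp : Exec p s s' T) : Exec (.branch e p q) s s' (e.cost + 1 + T)
  | branchFalse {e : Expr} {p q : Prog} {s s' : State} {T : ℕ} (he : e.eval s = 0)
      (hq : Exec q s s' T) : Exec (.branch e p q) s s' (e.cost + 1 + T)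
  | loopTrue {e : Expr} {p : Prog} {s₁ s₂ s₃ : State} {T₁ T₂ : ℕ} (he : e.eval s₁ ≠ 0)
      (hp : Exec p s₁ s₂ T₁) (hl : Exec (.loop e p) s₂ s₃ T₂) :
      Exec (.loop e p) s₁ s₃ (e.cost + 1 + T₁ + T₂)
  | loopFalse {e : Expr} {p : Prog} {s : State} (he : e.eval s = 0) :
      Exec (.loop e p) s s (e.cost + 1)

/-- Computations are deterministic, so that "the" final state and running time make sense. -/
theorem Exec.deterministic {p : Prog} {s s₁ : State} {T₁ : ℕ} (h₁ : Exec p s s₁ T₁) :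
    ∀ {s₂ : State} {T₂ : ℕ}, Exec p s s₂ T₂ → s₁ = s₂ ∧ T₁ = T₂ := by
  induction h₁ with
  | skip s => intro s₂ T₂ h; cases h; exact ⟨rfl, rfl⟩
  | assign s x e => intro s₂ T₂ h; cases h; exact ⟨rfl, rfl⟩
  | store s a e₁ e₂ => intro s₂ T₂ h; cases h; exact ⟨rfl, rfl⟩
  | seq hp hq ihp ihq =>
    intro s₂ T₂ h
    cases h with
    | seq hp' hq' =>
      obtain ⟨rfl, rfl⟩ := ihp hp'
      obtain ⟨rfl, rfl⟩ := ihq hq'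
      exact ⟨rfl, rfl⟩
  | branchTrue he hp ih =>
    intro s₂ T₂ h
    cases h with
    | branchTrue he' hp' => obtain ⟨rfl, rfl⟩ := ih hp'; exact ⟨rfl, rfl⟩
    | branchFalse he' hq' => exact absurd he' he
  | branchFalse he hq ih =>
    intro s₂ T₂ h
    cases h with
    | branchTrue he' hp' => exact absurd he he'
    | branchFalse he' hq' => obtain ⟨rfl, rfl⟩ := ih hq'; exact ⟨rfl, rfl⟩
  | loopTrue he hp hl ihp ihl =>
    intro s₂ T₂ h
    cases h with
    | loopTrue he' hp' hl' =>
      obtain ⟨rfl, rfl⟩ := ihp hp'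
      obtain ⟨rfl, rfl⟩ := ihl hl'
      exact ⟨rfl, rfl⟩
    | loopFalse he' => exact absurd he' he
  | loopFalse he =>
    intro s₂ T₂ h
    cases h with
    | loopTrue he' hp' hl' => exact absurd he he'
    | loopFalse he' => exact ⟨rfl, rfl⟩

open Classical in
/-- The initial state for the input `(G, k, t)`: the registers `0, 1, 2` hold `n, k, t`, array `0`
holds the adjacency matrix of `G` in row-major order, and everything else is `0`. -/
noncomputable def inputState {n : ℕ} (G : SimpleGraph (Fin n)) (k t : ℕ) : State where
  regs x := if x = 0 then n else if x = 1 then k else if x = 2 then t else 0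
  arrs a m :=
    if a = 0 ∧ ∃ i j : Fin n, m = (i : ℕ) * n + (j : ℕ) ∧ G.Adj i j then 1 else 0

open Classical in
/-- Started in state `s`, the program `p` halts within `T` steps and correctly answers, in
register `0`, whether the proposition `A` holds (`1` for yes, `0` for no). -/
def DecidesInTime (p : Prog) (s : State) (A : Prop) (T : ℕ) : Prop :=
  ∃ (s' : State) (T' : ℕ), Exec p s s' T' ∧ T' ≤ T ∧ s'.regs 0 = if A then 1 else 0

end RAM

/-! A solution is witnessed by at most `k * k` vertices: for every color `i` a center `x i i`, and
for every other color `j` a vertex `x i j` of color `j`, adjacent to the center wherever the problem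
demands it. The two problems differ only in the relation `R` of demanded adjacencies, `j ≠ i` or `j
< i` (`exists_coloring_iff_exists_isSystem`). Let `M = threshold k t`; the argument is a win-win on
the number of vertices of degree at least `M`.

If there are at least `M` of them, the answer is always yes, and this is the only place where
`K_{t,t}`-freeness is used. Fewer than `t` vertices can be adjacent to almost all of a large set
(`card_lt_of_card_sdiff_neighborFinset_le`). Hence a greedy choice yields `k` centers whose
neighborhoods differ pairwise in many vertices (`exists_incomparable_neighborFinsets`), and another
greedy choice picks from the sets `N(v i) \ N(v j)` distinct, pairwise non-adjacent vertices `x i j`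
(`exists_independent_transversal`).

Otherwise let `A` be the set of these fewer than `M` vertices. Any other vertex has a closed
neighborhood of size at most `M`, so its type, the pattern of adjacencies and equalities on `A`
followed by that neighborhood, takes a number of values bounded in `k` and `t`. It suffices to keep
`A` and the closed neighborhoods of up to `M ^ 4` vertices of each type. Indeed, a star of a
solution that is not kept can be moved along a local isomorphism to a kept vertex of the same type,
chosen so far from the other representatives, outside `A`, that no new adjacency or equality
appears; at most `k * k * (M * M)` choices are forbidden (`IsSystem.move`, `IsSystem.exists_mem`). A
list of bounded length remains, and all ways to fill the `k * k` cells from it are tried.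

The rest realizes this on the machine: a time-bounded Hoare logic (`Runs`), a numerical code for
types with `localIso_of_listCode_eq`, the invariant `Marked` of the marking phase, and the
exhaustive search. The input size enters only through loops over vertices, nested at most twice. -/

/-! ### Colorings as systems of representatives -/

section Representatives

variable {V : Type*}

/-- A system of representatives `x` for a coloring with `k` colors: `x i i` is a distinguished
vertex of color `i`, and `x i j` is a vertex of color `j`, adjacent to `x i i` whenever `R i j`. -/
structure IsSystem (G : SimpleGraph V) (k : ℕ) (R : ℕ → ℕ → Prop) (x : ℕ → ℕ → V) : Prop where
  adj : ∀ i < k, ∀ j < k, R i j → G.Adj (x i i) (x i j)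
  not_adj : ∀ i < k, ∀ i' < k, ∀ j < k, ¬ G.Adj (x i j) (x i' j)
  ne : ∀ i < k, ∀ i' < k, ∀ j < k, ∀ j' < k, j ≠ j' → x i j ≠ x i' j'

theorem IsSystem.congr {G : SimpleGraph V} {k : ℕ} {R : ℕ → ℕ → Prop} {x x' : ℕ → ℕ → V}
    (h : IsSystem G k R x) (hx : ∀ i < k, ∀ j < k, x i j = x' i j) : IsSystem G k R x' := by
  constructor
  · intro i hi j hj hR
    rw [← hx i hi i hi, ← hx i hi j hj]
    exact h.adj i hi j hj hR
  · intro i hi i' hi' j hj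
    rw [← hx i hi j hj, ← hx i' hi' j hj]
    exact h.not_adj i hi i' hi' j hj
  · intro i hi i' hi' j hj j' hj' hne
    have := h.ne i hi i' hi' j hj j' hj' hne
    rwa [hx i hi j hj, hx i' hi' j' hj'] at this

/-- Colorings of induced subgraphs in which every color `i` has a vertex that sees all colors `j`
with `R i j` correspond to systems of representatives. -/
theorem exists_coloring_iff_exists_isSystem (G : SimpleGraph V) {k : ℕ} (hk : 0 < k)
    (R : ℕ → ℕ → Prop) (hR : ∀ i, ¬ R i i) :
    (∃ (S : Set V) (C : (G.induce S).Coloring (Fin k)), ∀ i : Fin k, ∃ v, C v = i ∧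
      ∀ j : Fin k, R i j → ∃ u, (G.induce S).Adj v u ∧ C u = j) ↔ ∃ x, IsSystem G k R x := by
  classical
  constructor
  · rintro ⟨S, C, h⟩
    choose v hv hu using h
    choose u hu hC using hu
    -- Where no adjacency is demanded, the distinguished vertex of color `j` fills the cell, so
    -- every cell holds a vertex of the right color.
    let y : Fin k → Fin k → S := fun i j => if h : R i j then u i j h else v j
    have hy : ∀ i j, C (y i j) = j := by
      intro i j
      by_cases h : R i j <;> simp [y, h, hC, hv]
    have hyi : ∀ i, y i i = v i := by intro i; simp [y, hR]
    -- Cells with an index at least `k` are irrelevant; reduction modulo `k` merely gives them some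
    -- value.
    let q : ℕ → Fin k := fun i => ⟨i % k, Nat.mod_lt _ hk⟩
    have hq : ∀ i < k, ((q i : Fin k) : ℕ) = i := fun i hi => Nat.mod_eq_of_lt hi
    refine ⟨fun i j => (y (q i) (q j) : V), ?_, ?_, ?_⟩
    · intro i hi j hj hij
      have h1 : R (q i) (q j) := by rwa [hq i hi, hq j hj]
      have h2 := hu (q i) (q j) h1
      rw [hyi]
      simpa [y, h1] using h2
    · intro i hi i' hi' j hj hadj
      have : (G.induce S).Adj (y (q i) (q j)) (y (q i') (q j)) := by simpa using hadj
      exact C.valid this (by rw [hy, hy])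
    · intro i hi i' hi' j hj j' hj' hne heq
      have := congrArg C (Subtype.ext heq)
      rw [hy, hy] at this
      have := congrArg Fin.val this
      rw [hq j hj, hq j' hj'] at this
      exact hne this
  · rintro ⟨x, hx⟩
    let S : Set V := {v | ∃ i j : Fin k, x i j = v}
    have hS : ∀ v : S, ∃ j : Fin k, ∃ i : Fin k, x i j = v := fun ⟨v, i, j, h⟩ => ⟨j, i, h⟩
    choose c d hc using hS
    have hcx : ∀ (i j : Fin k) (h : x i j ∈ S), c ⟨x i j, h⟩ = j := by
      intro i j h
      by_contra hne
      exact hx.ne _ (d ⟨x i j, h⟩).2 _ i.2 _ (c ⟨x i j, h⟩).2 _ j.2 (fun h => hne (Fin.ext h))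
        (hc ⟨x i j, h⟩)
    have hmem : ∀ i j : Fin k, x i j ∈ S := fun i j => ⟨i, j, rfl⟩
    refine ⟨S, SimpleGraph.Coloring.mk c ?_, ?_⟩
    · intro v w hvw h
      have hvw : G.Adj v w := by simpa using hvw
      rw [← hc v, ← hc w, h] at hvw
      exact hx.not_adj _ (d v).2 _ (d w).2 _ (c w).2 hvw
    · intro i
      refine ⟨⟨x i i, hmem i i⟩, hcx i i _, fun j hij => ⟨⟨x i j, hmem i j⟩, ?_, hcx i j _⟩⟩
      simpa using hx.adj i i.2 j j.2 hij

theorem bChromaticCoreProblem_iff (G : SimpleGraph V) {k : ℕ} (hk : 0 < k) :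
    BChromaticCoreProblem G k ↔ ∃ x, IsSystem G k (fun i j => j ≠ i) x := by
  rw [← exists_coloring_iff_exists_isSystem G hk _ (by simp)]
  simp only [BChromaticCoreProblem, IsBColoring, ne_eq, Fin.ext_iff]

theorem partialGrundyColoringProblem_iff (G : SimpleGraph V) {k : ℕ} (hk : 0 < k) :
    PartialGrundyColoringProblem G k ↔ ∃ x, IsSystem G k (fun i j => j < i) x := by
  rw [← exists_coloring_iff_exists_isSystem G hk _ (by simp)]
  simp only [PartialGrundyColoringProblem, IsPartialGrundyColoring, Fin.lt_def]

end Representatives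

/-! ### Many vertices of high degree in graphs without large complete bipartite subgraphs -/

section HighDegree

variable {V : Type*} [Fintype V] [DecidableEq V] {G : SimpleGraph V} [DecidableRel G.Adj] {t : ℕ}

/-- In a `K_{t,t}`-free graph, fewer than `t` vertices are adjacent to almost all of a large set. -/
theorem card_lt_of_card_sdiff_neighborFinset_le
    (hG : (completeBipartiteGraph (Fin t) (Fin t)).Free G) {B U : Finset V} {g : ℕ}
    (hB : t * g + t ≤ B.card) (hU : ∀ u ∈ U, (B \ G.neighborFinset u).card ≤ g) : U.card < t := by
  by_contra! hcard
  -- Together, `t` vertices of `U` miss at most `t * g` vertices of `B`, so they have `t` common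
  -- neighbors in `B`: a forbidden `K_{t,t}`.
  obtain ⟨T, hTU, hT⟩ := Finset.exists_subset_card_eq hcard
  set E := T.biUnion fun u => B \ G.neighborFinset u with hE
  have h1 : E.card ≤ t * g := by
    rw [← hT]
    exact Finset.card_biUnion_le_card_mul _ _ _ fun u hu => hU u (hTU hu)
  have h2 : t ≤ (B \ E).card := by
    have := Finset.le_card_sdiff E B
    omega
  obtain ⟨T', hT'B, hT'⟩ := Finset.exists_subset_card_eq h2
  have hadj : ∀ u ∈ T, ∀ w ∈ T', G.Adj u w := by
    intro u hu w hw
    have := hT'B hw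
    simp only [hE, Finset.mem_sdiff, Finset.mem_biUnion, SimpleGraph.mem_neighborFinset] at this
    by_contra h
    exact this.2 ⟨u, hu, this.1, h⟩
  let a : Fin t ↪ V := (T.equivFinOfCardEq hT).symm.toEmbedding.trans (Function.Embedding.subtype _)
  let b : Fin t ↪ V :=
    (T'.equivFinOfCardEq hT').symm.toEmbedding.trans (Function.Embedding.subtype _)
  have ha : ∀ i, a i ∈ T := fun i => ((T.equivFinOfCardEq hT).symm i).2
  have hb : ∀ i, b i ∈ T' := fun i => ((T'.equivFinOfCardEq hT').symm i).2
  refine hG ⟨⟨⟨Sum.elim a b, ?_⟩, ?_⟩⟩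
  · rintro (i | i) (j | j) h <;> simp at h
    · exact hadj _ (ha i) _ (hb j)
    · exact (hadj _ (ha j) _ (hb i)).symm
  -- The two sides are disjoint, since a common vertex would be adjacent to itself.
  · rintro (i | i) (j | j) h <;> simp at h
    · exact congrArg _ h
    · exact absurd (hadj _ (ha i) _ (hb j)) (by simp [h])
    · exact absurd (hadj _ (ha j) _ (hb i)) (by simp [h])
    · exact congrArg _ h

/-- The iterated squares that serve as thresholds. -/
def iterSq (x : ℕ) : ℕ → ℕ
  | 0 => x
  | m + 1 => iterSq x m * iterSq x m

theorem le_iterSq (x m : ℕ) : x ≤ iterSq x m := by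
  induction m with
  | zero => exact le_rfl
  | succ m ih => exact ih.trans (Nat.le_mul_self _)

theorem iterSq_mono (x : ℕ) {a b : ℕ} (h : a ≤ b) : iterSq x a ≤ iterSq x b :=
  monotone_nat_of_le_succ (fun _ => Nat.le_mul_self _) h

/-- Large sets of vertices of a `K_{t,t}`-free graph have an independent system of distinct
representatives. -/
theorem exists_independent_transversal [Nonempty V]
    (hG : (completeBipartiteGraph (Fin t) (Fin t)).Free G) {ι : Type*} [DecidableEq ι]
    {x : ℕ} (I : Finset ι) (hx : t + I.card + 2 ≤ x) (B : ι → Finset V)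
    (hB : ∀ i ∈ I, iterSq x I.card ≤ (B i).card) :
    ∃ u : ι → V, (∀ i ∈ I, u i ∈ B i) ∧ (∀ i ∈ I, ∀ j ∈ I, i ≠ j → u i ≠ u j) ∧
      ∀ i ∈ I, ∀ j ∈ I, ¬ G.Adj (u i) (u j) := by
  induction I using Finset.induction_on generalizing B with
  | empty =>
    exact ⟨fun _ => Classical.arbitrary V, by simp⟩
  | insert i₀ I hi₀ ih =>
    rw [Finset.card_insert_of_notMem hi₀] at hx hB
    set g := iterSq x I.card with hg
    have hxg : x ≤ g := le_iterSq _ _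
    have hgg : iterSq x (I.card + 1) = g * g := rfl
    have hsq : t * g + (I.card + 2) * g ≤ g * g := by
      rw [← add_mul]; exact Nat.mul_le_mul_right _ (by omega)
    have hIg : I.card * t ≤ I.card * g := Nat.mul_le_mul_left _ (by omega)
    -- A vertex of `bad i` would exhaust `B i`. Each `bad i` has at most `t` elements, so `B i₀`, of
    -- size at least `g * g`, contains a vertex `u₀` in none of them.
    let bad : ι → Finset V := fun i => (B i₀).filter fun u => (B i \ G.neighborFinset u).card ≤ g
    have hbad : ∀ i ∈ I, (bad i).card ≤ t := fun i hi =>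
      (card_lt_of_card_sdiff_neighborFinset_le hG (B := B i) (g := g)
        (by have := hB i (Finset.mem_insert_of_mem hi); nlinarith)
        (fun u hu => (Finset.mem_filter.1 hu).2)).le
    have hlt : (I.biUnion bad).card < (B i₀).card := by
      have h1 : (I.biUnion bad).card ≤ I.card * t := Finset.card_biUnion_le_card_mul _ _ _ hbad
      have h2 := hB i₀ (Finset.mem_insert_self _ _)
      nlinarith
    obtain ⟨u₀, hu₀, hu₀'⟩ := Finset.exists_mem_notMem_of_card_lt_card hlt
    -- More than `g` vertices of `B i` are non-neighbors of `u₀`, so at least `g` remain after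
    -- erasing `u₀` itself: exactly the threshold for one index fewer.
    obtain ⟨u, hu, hne, hadj⟩ := ih (by omega)
      (fun i => (B i \ G.neighborFinset u₀).erase u₀) (by
        intro i hi
        have h1 : g < (B i \ G.neighborFinset u₀).card := by
          by_contra! h
          exact hu₀' (Finset.mem_biUnion.2 ⟨i, hi, Finset.mem_filter.2 ⟨hu₀, h⟩⟩)
        have := Finset.pred_card_le_card_erase (s := B i \ G.neighborFinset u₀) (a := u₀)
        omega)
    have hu' : ∀ i ∈ I, u i ≠ u₀ ∧ u i ∈ B i ∧ ¬ G.Adj u₀ (u i) := fun i hi => by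
      simpa using hu i hi
    have hi' : ∀ i ∈ I, i ≠ i₀ := fun i hi h => hi₀ (h ▸ hi)
    refine ⟨Function.update u i₀ u₀, ?_, ?_, ?_⟩
    · intro i hi
      rcases Finset.mem_insert.1 hi with rfl | hi
      · simpa using hu₀
      · simpa [hi' i hi] using (hu' i hi).2.1
    · intro i hi j hj hij
      rcases Finset.mem_insert.1 hi with rfl | hi₁ <;> rcases Finset.mem_insert.1 hj with rfl | hj₁
      · exact absurd rfl hij
      · simpa [hi' j hj₁] using (hu' j hj₁).1.symm
      · simpa [hi' i hi₁] using (hu' i hi₁).1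
      · simpa [hi' i hi₁, hi' j hj₁] using hne i hi₁ j hj₁ hij
    · intro i hi j hj
      rcases Finset.mem_insert.1 hi with rfl | hi₁ <;> rcases Finset.mem_insert.1 hj with rfl | hj₁
      · simp
      · simpa [hi' j hj₁] using (hu' j hj₁).2.2
      · simpa [hi' i hi₁, G.adj_comm] using (hu' i hi₁).2.2
      · simpa [hi' i hi₁, hi' j hj₁] using hadj i hi₁ j hj₁

/-- Among many vertices of high degree, `k` have pairwise incomparable neighborhoods. -/
theorem exists_incomparable_neighborFinsets [Nonempty V]
    (hG : (completeBipartiteGraph (Fin t) (Fin t)).Free G) {g : ℕ} (k : ℕ) (X : Finset V)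
    (hX : k * t ≤ X.card) (hdeg : ∀ v ∈ X, t * g + t ≤ G.degree v) :
    ∃ v : ℕ → V, (∀ i < k, v i ∈ X) ∧ ∀ i < k, ∀ j < k, i ≠ j →
      g < (G.neighborFinset (v i) \ G.neighborFinset (v j)).card := by
  induction k generalizing X with
  | zero => exact ⟨fun _ => Classical.arbitrary V, by simp⟩
  | succ k ih =>
    -- Every graph contains `K_{0,0}`; for `t = 0` the counting lemma with empty sets gives `0 < 0`.
    have ht : 0 < t := by
      rcases Nat.eq_zero_or_pos t with rfl | h
      · exact card_lt_of_card_sdiff_neighborFinset_le hG (B := ∅) (U := ∅) (g := 0)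
          (by simp) (by simp)
      · exact h
    have hne : X.Nonempty := Finset.card_pos.1 (by nlinarith)
    -- Minimality of the degree makes the estimate symmetric: if `N(v₀) \ N(w)` is large, then `N(w)
    -- \ N(v₀)` is at least as large.
    obtain ⟨v₀, hv₀, hmin⟩ := X.exists_min_image (fun v => G.degree v) hne
    set bad := X.filter fun w => (G.neighborFinset v₀ \ G.neighborFinset w).card ≤ g with hbad
    have hbadt : bad.card < t := card_lt_of_card_sdiff_neighborFinset_le hG (hdeg v₀ hv₀)
      (fun w hw => (Finset.mem_filter.1 hw).2)
    obtain ⟨v, hv, hvv⟩ := ih (X \ bad) (by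
      have := Finset.le_card_sdiff bad X
      rw [add_mul] at hX
      omega) (fun v hv => hdeg v (Finset.mem_sdiff.1 hv).1)
    have h₁ : ∀ i < k, g < (G.neighborFinset v₀ \ G.neighborFinset (v i)).card := by
      intro i hi
      have := hv i hi
      rw [hbad] at this
      simp only [Finset.mem_sdiff, Finset.mem_filter, not_and, not_le] at this
      exact this.2 this.1
    have h₂ : ∀ i < k, g < (G.neighborFinset (v i) \ G.neighborFinset v₀).card := by
      intro i hi
      have e₁ := Finset.card_sdiff_add_card_inter (G.neighborFinset (v i)) (G.neighborFinset v₀)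
      have e₂ := Finset.card_sdiff_add_card_inter (G.neighborFinset v₀) (G.neighborFinset (v i))
      have := hmin (v i) (Finset.mem_sdiff.1 (hv i hi)).1
      rw [← G.card_neighborFinset_eq_degree, ← G.card_neighborFinset_eq_degree] at this
      rw [Finset.inter_comm] at e₂
      have := h₁ i hi
      omega
    refine ⟨fun i => if i = k then v₀ else v i, ?_, ?_⟩
    · intro i hi
      by_cases h : i = k
      · simpa [h] using hv₀
      · simpa [h] using (Finset.mem_sdiff.1 (hv i (by omega))).1
    · intro i hi j hj hij
      by_cases h : i = k <;> by_cases h' : j = k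
      · omega
      · beta_reduce
        rw [if_pos h, if_neg h']
        exact h₁ j (by omega)
      · beta_reduce
        rw [if_neg h, if_pos h']
        exact h₂ i (by omega)
      · beta_reduce
        rw [if_neg h, if_neg h']
        exact hvv i (by omega) j (by omega) hij

/-- The degree threshold. -/
def threshold (k t : ℕ) : ℕ := iterSq (k * k + k + t + 2) (k * k + 1)

theorem mul_self_lt_threshold (k t : ℕ) : k * k < threshold k t :=
  lt_of_lt_of_le (by omega) (le_iterSq (k * k + k + t + 2) _)

/-- A `K_{t,t}`-free graph with many vertices of high degree has a system of representatives. -/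
theorem exists_isSystem_of_threshold_le_card
    (hG : (completeBipartiteGraph (Fin t) (Fin t)).Free G) {k : ℕ} (R : ℕ → ℕ → Prop)
    (hR : ∀ i, ¬ R i i)
    (hcard : threshold k t ≤ (Finset.univ.filter fun v => threshold k t ≤ G.degree v).card) :
    ∃ x, IsSystem G k R x := by
  set X := Finset.univ.filter fun v => threshold k t ≤ G.degree v with hX
  have hne : X.Nonempty := Finset.card_pos.1 ((mul_self_lt_threshold k t).pos.trans_le hcard)
  have : Nonempty V := ⟨hne.choose⟩
  set x₀ := k * k + k + t + 2 with hx₀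
  set γ := iterSq x₀ (k * k) with hγ
  have hthr : threshold k t = γ * γ := rfl
  have hxγ : x₀ ≤ γ := le_iterSq _ _
  have hsq : (t + k + 2) * γ ≤ γ * γ := Nat.mul_le_mul_right _ (by nlinarith)
  have htk : t * (k + 1) ≤ γ * (k + 1) := Nat.mul_le_mul_right _ (by nlinarith)
  have hkt : t * k ≤ γ * k := Nat.mul_le_mul_right _ (by nlinarith)
  -- The summand `k` in `γ + k` pays for removing the set `Z` of centers from the differences below.
  obtain ⟨v, hv, hvv⟩ := exists_incomparable_neighborFinsets hG (g := γ + k) k X (by nlinarith)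
    (fun w hw => by
      have : threshold k t ≤ G.degree w := by simpa [hX] using hw
      nlinarith)
  let Z := (Finset.range k).image v
  have hZ : Z.card ≤ k := by simpa using Finset.card_image_le (s := Finset.range k) (f := v)
  have hvZ : ∀ i < k, v i ∈ Z := fun i hi => Finset.mem_image_of_mem _ (Finset.mem_range.2 hi)
  have hI : (Finset.range k).offDiag.card ≤ k * k := by
    rw [Finset.offDiag_card, Finset.card_range]; exact Nat.sub_le _ _
  -- The vertex for the pair `(i, j)` must see the center `v i`, must not see the center `v j` of
  -- its own color, and must not be a center. There are at most `k * k` pairs, which explains the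
  -- exponent in `γ`.
  obtain ⟨u, hu, hune, huadj⟩ := exists_independent_transversal hG (x := x₀)
    (Finset.range k).offDiag (by nlinarith)
    (fun p => (G.neighborFinset (v p.1) \ G.neighborFinset (v p.2)) \ Z) (by
      rintro ⟨i, j⟩ hij
      simp only [Finset.mem_offDiag, Finset.mem_range] at hij
      have h₁ := hvv i hij.1 j hij.2.1 hij.2.2
      have h₂ := Finset.le_card_sdiff Z (G.neighborFinset (v i) \ G.neighborFinset (v j))
      have h₃ := iterSq_mono x₀ hI
      change _ ≤ ((G.neighborFinset (v i) \ G.neighborFinset (v j)) \ Z).card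
      omega)
  have hmem : ∀ i < k, ∀ j < k, i ≠ j → (i, j) ∈ (Finset.range k).offDiag := by
    intro i hi j hj hij; simp [hi, hj, hij]
  have hu' : ∀ i < k, ∀ j < k, i ≠ j →
      (G.Adj (v i) (u (i, j)) ∧ ¬ G.Adj (v j) (u (i, j))) ∧ u (i, j) ∉ Z := by
    intro i hi j hj hij
    simpa using hu (i, j) (hmem i hi j hj hij)
  refine ⟨fun i j => if i = j then v i else u (i, j), ?_, ?_, ?_⟩
  · intro i hi j hj hij
    have hne : i ≠ j := fun h => hR i (h ▸ hij)
    simpa [hne] using (hu' i hi j hj hne).1.1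
  · intro i hi i' hi' j hj
    by_cases h : i = j <;> by_cases h' : i' = j
    · simp [h, h']
    · simpa [h, h'] using (hu' i' hi' j hj h').1.2
    · simpa [h, h', G.adj_comm] using (hu' i hi j hj h).1.2
    · simpa [h, h'] using huadj _ (hmem i hi j hj h) _ (hmem i' hi' j hj h')
  · intro i hi i' hi' j hj j' hj' hjj
    by_cases h : i = j <;> by_cases h' : i' = j'
    · subst h h'
      have := hvv i hi i' hi' hjj
      intro heq
      replace heq : v i = v i' := by simpa using heq
      rw [heq, Finset.sdiff_self] at this
      simp at this
    · intro heq
      simp only [h, h', if_true, if_false] at heq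
      exact (hu' i' hi' j' hj' h').2 (heq ▸ hvZ j hj)
    · intro heq
      simp only [h, h', if_true, if_false] at heq
      exact (hu' i hi j hj h).2 (heq ▸ hvZ j' hj')
    · simpa [h, h'] using hune _ (hmem i hi j hj h) _ (hmem i' hi' j' hj' h')
        (fun e => hjj (congrArg Prod.snd e))

end HighDegree

/-! ### Few vertices of high degree: restricting the search to a bounded set -/

section Kernel

variable {V : Type*} (G : SimpleGraph V)

/-- Some map fixes `A` pointwise, sends `u` to `v`, and preserves adjacency and equality on
the union of `A` and the closed neighborhood of `u`. -/
def LocalIso (A : Finset V) (u v : V) : Prop :=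
  ∃ φ : V → V, (∀ a ∈ A, φ a = a) ∧ φ u = v ∧ ∀ y y', (y ∈ A ∨ y = u ∨ G.Adj u y) →
    (y' ∈ A ∨ y' = u ∨ G.Adj u y') →
      (G.Adj (φ y) (φ y') ↔ G.Adj y y') ∧ (φ y = φ y' ↔ y = y')

variable {G}

/-- Moving some of the representatives along a local isomorphism, far away from all others. -/
theorem IsSystem.move {k : ℕ} {R : ℕ → ℕ → Prop} {x : ℕ → ℕ → V} (hx : IsSystem G k R x)
    {A : Finset V} {r v : V} {φ : V → V} (hφA : ∀ a ∈ A, φ a = a) (hφr : φ r = v)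
    (hφ : ∀ y y', (y ∈ A ∨ y = r ∨ G.Adj r y) → (y' ∈ A ∨ y' = r ∨ G.Adj r y') →
      (G.Adj (φ y) (φ y') ↔ G.Adj y y') ∧ (φ y = φ y' ↔ y = y'))
    (U : ℕ → ℕ → Prop) [∀ i j, Decidable (U i j)]
    (hUA : ∀ i j, U i j → x i j ∉ A) (hUr : ∀ i j, U i j → x i j = r ∨ G.Adj r (x i j))
    (hUR : ∀ i < k, ∀ j < k, R i j → (U i i → U i j ∨ x i j ∈ A) ∧ (U i j → U i i ∨ x i i ∈ A))
    (hfar : ∀ i < k, ∀ j < k, x i j ∉ A → ∀ z, z ∉ A → (z = x i j ∨ G.Adj (x i j) z) →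
      ¬ (v = z ∨ G.Adj z v)) :
    IsSystem G k R (fun i j => if U i j then φ (x i j) else x i j) := by
  set x' : ℕ → ℕ → V := fun i j => if U i j then φ (x i j) else x i j with hx'
  have hgood : ∀ i j, (U i j ∨ x i j ∈ A) →
      x' i j = φ (x i j) ∧ (x i j ∈ A ∨ x i j = r ∨ G.Adj r (x i j)) := by
    rintro i j (h | h)
    · exact ⟨by simp [hx', h], Or.inr (hUr i j h)⟩
    · by_cases hU : U i j
      · exact absurd h (hUA i j hU)
      · exact ⟨by simp [hx', hU, hφA _ h], Or.inl h⟩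
  -- Relations persist between two vertices that are moved or in `A`, because `φ` preserves them
  -- there and fixes `A`, and trivially between two unmoved vertices.
  have hsame : ∀ i j i' j', ((U i j ∨ x i j ∈ A) ∧ (U i' j' ∨ x i' j' ∈ A)) ∨
      (¬ U i j ∧ ¬ U i' j') → (G.Adj (x' i j) (x' i' j') ↔ G.Adj (x i j) (x i' j')) ∧
        (x' i j = x' i' j' ↔ x i j = x i' j') := by
    rintro i j i' j' (⟨h, h'⟩ | ⟨h, h'⟩)
    · rw [(hgood i j h).1, (hgood i' j' h').1]
      exact hφ _ _ (hgood i j h).2 (hgood i' j' h').2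
    · simp [hx', h, h']
  -- A moved vertex lies in the closed neighborhood of `v` and outside `A`. An unmoved
  -- representative outside `A` that equals it or sees it would contradict `hfar`.
  have hdiff : ∀ i j, ∀ i' < k, ∀ j' < k, U i j → ¬ U i' j' → x i' j' ∉ A →
      ¬ G.Adj (x' i' j') (x' i j) ∧ x' i j ≠ x' i' j' := by
    intro i j i' hi' j' hj' hU hU' hA'
    have e : x' i' j' = x i' j' := by simp [hx', hU']
    have e₁ := (hgood i j (Or.inl hU)).1
    -- An image in `A` is fixed by `φ`, hence has the same image as the original vertex; injectivity
    -- identifies the two and puts the original into `A`.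
    have hzA : x' i j ∉ A := by
      intro h
      rw [e₁] at h
      have := (hφ _ _ (Or.inl h) (Or.inr (hUr i j hU))).2.1 (hφA _ h)
      exact hUA i j hU (this ▸ h)
    have hzv : v = x' i j ∨ G.Adj (x' i j) v := by
      rcases hUr i j hU with h | h
      · left; rw [e₁, h, hφr]
      · right
        rw [e₁, ← hφr]
        exact (hφ _ _ (Or.inr (Or.inr h)) (Or.inr (Or.inl rfl))).1.2 h.symm
    have := hfar i' hi' j' hj' hA' _ hzA
    rw [← e] at this
    exact ⟨fun h => this (Or.inr h) hzv, fun h => this (Or.inl h) hzv⟩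
  -- Becoming distinct and non-adjacent never violates `not_adj` or `ne`. Demanded adjacencies are
  -- safe because `hUR` puts their pairs in the scope of `hsame`.
  have hpair : ∀ i < k, ∀ j < k, ∀ i' < k, ∀ j' < k,
      ((G.Adj (x' i j) (x' i' j') ↔ G.Adj (x i j) (x i' j')) ∧
        (x' i j = x' i' j' ↔ x i j = x i' j')) ∨
      (¬ G.Adj (x' i j) (x' i' j') ∧ x' i j ≠ x' i' j') := by
    intro i hi j hj i' hi' j' hj'
    by_cases h : U i j <;> by_cases h' : U i' j'
    · exact Or.inl (hsame _ _ _ _ (Or.inl ⟨Or.inl h, Or.inl h'⟩))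
    · by_cases hA : x i' j' ∈ A
      · exact Or.inl (hsame _ _ _ _ (Or.inl ⟨Or.inl h, Or.inr hA⟩))
      · have := hdiff i j i' hi' j' hj' h h' hA
        exact Or.inr ⟨fun h => this.1 h.symm, this.2⟩
    · by_cases hA : x i j ∈ A
      · exact Or.inl (hsame _ _ _ _ (Or.inl ⟨Or.inr hA, Or.inl h'⟩))
      · have := hdiff i' j' i hi j hj h' h hA
        exact Or.inr ⟨this.1, this.2.symm⟩
    · exact Or.inl (hsame _ _ _ _ (Or.inr ⟨h, h'⟩))
  refine ⟨fun i hi j hj hR => ?_, fun i hi i' hi' j hj => ?_, fun i hi i' hi' j hj j' hj' hne => ?_⟩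
  · refine (hsame i i i j ?_).1.2 (hx.adj i hi j hj hR)
    have := hUR i hi j hj hR
    by_cases h : U i i <;> by_cases h' : U i j <;> tauto
  · rcases hpair i hi j hj i' hi' j hj with h | h
    · exact fun h' => hx.not_adj i hi i' hi' j hj (h.1.1 h')
    · exact h.1
  · rcases hpair i hi j hj i' hi' j' hj' with h | h
    · exact fun h' => hx.ne i hi i' hi' j hj j' hj' hne (h.2.1 h')
    · exact h.2

/-- If all vertices outside `A` have small degree, and every vertex outside `A` and `Mk` is locally
isomorphic to many vertices of `Mk`, then a system of representatives can be found in `A` and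
the neighborhood of `Mk`. -/
theorem IsSystem.exists_mem [DecidableEq V] {k M N : ℕ} {R : ℕ → ℕ → Prop} {x : ℕ → ℕ → V}
    (hx : IsSystem G k R x) {A Mk W : Finset V} {D : Set V} {nb : V → Finset V}
    (hnb : ∀ v y, y ∈ nb v ↔ y = v ∨ G.Adj v y) (hlow : ∀ v, v ∉ A → (nb v).card ≤ M)
    (hMk : ∀ v ∈ D, v ∉ A → v ∉ Mk → ∃ F ⊆ Mk, N < F.card ∧ ∀ w ∈ F, LocalIso G A v w)
    (hN : k * k * (M * M) ≤ N) (hA : A ⊆ W) (hW : ∀ v ∈ Mk, nb v ⊆ W) (hD : ∀ v ∈ W, v ∈ D)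
    (hxD : ∀ i < k, ∀ j < k, x i j ∈ D) :
    ∃ x', IsSystem G k R x' ∧ ∀ i < k, ∀ j < k, x' i j ∈ W := by
  classical
  induction hb : ((Finset.range k ×ˢ Finset.range k).filter fun p => x p.1 p.2 ∉ W).card
    using Nat.strong_induction_on generalizing x with
  | _ b ih =>
  by_cases hall : ∀ i < k, ∀ j < k, x i j ∈ W
  · exact ⟨x, hx, hall⟩
  push Not at hall
  obtain ⟨i₀, hi₀, j₀, hj₀, h₀⟩ := hall
  -- The cells to be moved together: if the center of row `i₀` is outside `A` and the cell is the
  -- center or demands adjacency to it, then the center and all its demanded neighbors outside `A`;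
  -- otherwise the single cell, whose center lies in `A` if adjacency is demanded.
  have hmove : ∃ (r : V) (U : ℕ → ℕ → Prop), U i₀ j₀ ∧ r ∈ D ∧ r ∉ A ∧
      (∀ i j, U i j → x i j ∉ A) ∧ (∀ i j, U i j → x i j = r ∨ G.Adj r (x i j)) ∧
      (∀ i < k, ∀ j < k, R i j → (U i i → U i j ∨ x i j ∈ A) ∧ (U i j → U i i ∨ x i i ∈ A)) ∧
      ∀ i j, U i j → i < k ∧ j < k := by
    have h₀A : x i₀ j₀ ∉ A := fun h => h₀ (hA h)
    by_cases hc : x i₀ i₀ ∉ A ∧ (j₀ = i₀ ∨ R i₀ j₀)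
    · refine ⟨x i₀ i₀, fun i j => i = i₀ ∧ j < k ∧ (j = i₀ ∨ R i₀ j) ∧ x i j ∉ A,
        ⟨rfl, hj₀, hc.2, h₀A⟩, hxD _ hi₀ _ hi₀, hc.1, fun i j h => h.2.2.2, ?_, ?_, ?_⟩
      · rintro i j ⟨rfl, hj, rfl | hR, -⟩
        · exact Or.inl rfl
        · exact Or.inr (hx.adj i hi₀ j hj hR)
      · intro i hi j hj hR
        constructor
        · rintro ⟨rfl, -, -, -⟩
          by_cases h : x i j ∈ A
          · exact Or.inr h
          · exact Or.inl ⟨rfl, hj, Or.inr hR, h⟩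
        · rintro ⟨rfl, -, -, -⟩
          exact Or.inl ⟨rfl, hi, Or.inl rfl, hc.1⟩
      · rintro i j ⟨rfl, hj, -, -⟩
        exact ⟨hi₀, hj⟩
    · refine ⟨x i₀ j₀, fun i j => i = i₀ ∧ j = j₀, ⟨rfl, rfl⟩, hxD _ hi₀ _ hj₀, h₀A, ?_, ?_, ?_, ?_⟩
      · rintro i j ⟨rfl, rfl⟩; exact h₀A
      · rintro i j ⟨rfl, rfl⟩; exact Or.inl rfl
      · intro i hi j hj hR
        constructor
        · rintro ⟨rfl, rfl⟩; exact absurd ⟨h₀A, Or.inl rfl⟩ hc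
        · rintro ⟨rfl, rfl⟩
          by_contra h
          exact hc ⟨fun h' => h (Or.inr h'), Or.inr hR⟩
      · rintro i j ⟨rfl, rfl⟩; exact ⟨hi₀, hj₀⟩
  obtain ⟨r, U, hU₀, hrD, hrA, hUA, hUr, hUR, hUk⟩ := hmove
  -- The closed neighborhoods of marked vertices lie in `W`, but `x i₀ j₀` is in that of `r` and not
  -- in `W`.
  have hrMk : r ∉ Mk := fun h => h₀ (hW r h ((hnb _ _).2 (hUr _ _ hU₀)))
  obtain ⟨F, hFMk, hFcard, hF⟩ := hMk r hrD hrA hrMk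
  -- The forbidden targets: vertices reached from a representative outside `A` by at most two steps
  -- whose midpoint avoids `A`. Degrees along such steps are small, which gives `M * M` per cell.
  let E : Finset V := (Finset.range k ×ˢ Finset.range k).biUnion fun p =>
    if x p.1 p.2 ∈ A then ∅ else ((nb (x p.1 p.2)).filter (· ∉ A)).biUnion nb
  have hE : E.card ≤ k * k * (M * M) := by
    have := Finset.card_biUnion_le_card_mul (Finset.range k ×ˢ Finset.range k) (fun p =>
      if x p.1 p.2 ∈ A then ∅ else ((nb (x p.1 p.2)).filter (· ∉ A)).biUnion nb) (M * M) (by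
        intro p _
        split_ifs with h
        · simp
        · refine (Finset.card_biUnion_le_card_mul _ _ M ?_).trans
            (Nat.mul_le_mul_right _ ((Finset.card_filter_le _ _).trans (hlow _ h)))
          exact fun z hz => hlow z (Finset.mem_filter.1 hz).2)
    rwa [Finset.card_product, Finset.card_range] at this
  obtain ⟨v, hvF, hvE⟩ := Finset.exists_mem_notMem_of_card_lt_card
    (hE.trans_lt (hN.trans_lt hFcard))
  obtain ⟨φ, hφA, hφr, hφ⟩ := hF v hvF
  have hx' := hx.move hφA hφr hφ U hUA hUr hUR (by
    intro i hi j hj hA z hz hadj hv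
    refine hvE (Finset.mem_biUnion.2 ⟨(i, j), by simp [hi, hj], ?_⟩)
    simp only [hA, if_false, Finset.mem_biUnion, Finset.mem_filter]
    exact ⟨z, ⟨(hnb _ _).2 hadj, hz⟩, (hnb _ _).2 hv⟩)
  have hUW : ∀ i j, U i j → φ (x i j) ∈ W := by
    intro i j h
    refine hW v (hFMk hvF) ((hnb _ _).2 ?_)
    rcases hUr i j h with h | h
    · left; rw [h, hφr]
    · right
      rw [← hφr]
      exact (hφ _ _ (Or.inr (Or.inl rfl)) (Or.inr (Or.inr h))).1.2 h
  -- Moved cells land in the closed neighborhood of `v`, inside `W`, and the others stay, so the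
  -- number of cells outside `W` drops.
  refine ih _ ?_ hx' ?_ rfl
  · rw [← hb]
    refine Finset.card_lt_card (Finset.ssubset_iff_of_subset ?_ |>.2 ⟨(i₀, j₀), ?_, ?_⟩)
    · intro p hp
      simp only [Finset.mem_filter] at hp ⊢
      refine ⟨hp.1, ?_⟩
      by_cases h : U p.1 p.2
      · exact absurd (hUW _ _ h) (by simpa [h] using hp.2)
      · simpa [h] using hp.2
    · simp [hi₀, hj₀, h₀]
    · simp [hU₀, hUW _ _ hU₀]
  · intro i hi j hj
    by_cases h : U i j
    · simpa [h] using hD _ (hUW _ _ h)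
    · simpa [h] using hxD i hi j hj

end Kernel

/-! ### Reasoning about random access machines -/

namespace RAM

/-- The registers that a program may write. -/
def Prog.regsOut : Prog → List ℕ
  | .skip => []
  | .assign x _ => [x]
  | .store _ _ _ => []
  | .seq p q => p.regsOut ++ q.regsOut
  | .branch _ p q => p.regsOut ++ q.regsOut
  | .loop _ p => p.regsOut

/-- The arrays that a program may write. -/
def Prog.arrsOut : Prog → List ℕ
  | .skip => []
  | .assign _ _ => []
  | .store a _ _ => [a]
  | .seq p q => p.arrsOut ++ q.arrsOut
  | .branch _ p q => p.arrsOut ++ q.arrsOut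
  | .loop _ p => p.arrsOut

/-- The states `s` and `s'` differ only in what the program `p` may write. -/
structure Frame (p : Prog) (s s' : State) : Prop where
  regs : ∀ x, x ∉ p.regsOut → s'.regs x = s.regs x
  arrs : ∀ a, a ∉ p.arrsOut → s'.arrs a = s.arrs a

/-- Thanks to this, a specification need only mention what a program computes; that everything else
persists is a syntactic check on its outputs. -/
theorem Exec.frame {p : Prog} {s s' : State} {T : ℕ} (h : Exec p s s' T) : Frame p s s' := by
  induction h with
  | skip s => exact ⟨fun _ _ => rfl, fun _ _ => rfl⟩
  | assign s x e =>
    refine ⟨fun y hy => ?_, fun _ _ => rfl⟩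
    simp only [Prog.regsOut, List.mem_singleton] at hy
    simp [State.setReg, hy]
  | store s a e₁ e₂ =>
    refine ⟨fun _ _ => rfl, fun b hb => ?_⟩
    simp only [Prog.arrsOut, List.mem_singleton] at hb
    simp [State.setArr, hb]
  | seq _ _ ih₁ ih₂ =>
    constructor
    · intro x hx
      simp only [Prog.regsOut, List.mem_append, not_or] at hx
      rw [ih₂.regs x hx.2, ih₁.regs x hx.1]
    · intro x hx
      simp only [Prog.arrsOut, List.mem_append, not_or] at hx
      rw [ih₂.arrs x hx.2, ih₁.arrs x hx.1]
  | branchTrue _ _ ih =>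
    constructor
    · intro x hx
      simp only [Prog.regsOut, List.mem_append, not_or] at hx
      exact ih.regs x hx.1
    · intro x hx
      simp only [Prog.arrsOut, List.mem_append, not_or] at hx
      exact ih.arrs x hx.1
  | branchFalse _ _ ih =>
    constructor
    · intro x hx
      simp only [Prog.regsOut, List.mem_append, not_or] at hx
      exact ih.regs x hx.2
    · intro x hx
      simp only [Prog.arrsOut, List.mem_append, not_or] at hx
      exact ih.arrs x hx.2
  | loopTrue _ _ _ ih₁ ih₂ =>
    exact ⟨fun x hx => by rw [ih₂.regs x hx, ih₁.regs x hx],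
      fun x hx => by rw [ih₂.arrs x hx, ih₁.arrs x hx]⟩
  | loopFalse _ => exact ⟨fun _ _ => rfl, fun _ _ => rfl⟩

/-- Started in state `s`, the program `p` halts within `T` steps in a state with property `Q`. -/
def Runs (p : Prog) (s : State) (T : ℕ) (Q : State → Prop) : Prop :=
  ∃ (s' : State) (T' : ℕ), Exec p s s' T' ∧ T' ≤ T ∧ Q s'

variable {p q : Prog} {s : State} {T T₁ T₂ : ℕ} {Q Q₁ : State → Prop}

theorem Runs.mono (h : Runs p s T₁ Q₁) (hT : T₁ ≤ T) (hQ : ∀ s', Q₁ s' → Frame p s s' → Q s') :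
    Runs p s T Q := by
  obtain ⟨s', T', he, hT', hq⟩ := h
  exact ⟨s', T', he, hT'.trans hT, hQ s' hq he.frame⟩

theorem Runs.skip (hQ : Q s) (hT : 1 ≤ T) : Runs .skip s T Q :=
  ⟨s, 1, Exec.skip s, hT, hQ⟩

theorem Runs.assign {x : ℕ} {e : Expr} (hQ : Q (s.setReg x (e.eval s))) (hT : e.cost + 1 ≤ T) :
    Runs (.assign x e) s T Q :=
  ⟨_, _, Exec.assign s x e, hT, hQ⟩

theorem Runs.store {a : ℕ} {e₁ e₂ : Expr} (hQ : Q (s.setArr a (e₁.eval s) (e₂.eval s)))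
    (hT : e₁.cost + e₂.cost + 1 ≤ T) : Runs (.store a e₁ e₂) s T Q :=
  ⟨_, _, Exec.store s a e₁ e₂, hT, hQ⟩

theorem Runs.seq (h₁ : Runs p s T₁ Q₁) (h₂ : ∀ s₁, Q₁ s₁ → Frame p s s₁ → Runs q s₁ T₂ Q)
    (hT : T₁ + T₂ ≤ T) : Runs (.seq p q) s T Q := by
  obtain ⟨s₁, T₁', he₁, hT₁, hq₁⟩ := h₁
  obtain ⟨s₂, T₂', he₂, hT₂, hq₂⟩ := h₂ s₁ hq₁ he₁.frame
  exact ⟨s₂, _, Exec.seq he₁ he₂, by omega, hq₂⟩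

theorem Runs.assign_seq {x : ℕ} {e : Expr} (h : Runs q (s.setReg x (e.eval s)) T₂ Q)
    (hT : e.cost + 1 + T₂ ≤ T) : Runs (.seq (.assign x e) q) s T Q := by
  obtain ⟨s₂, T₂', he₂, hT₂, hq₂⟩ := h
  exact ⟨s₂, _, Exec.seq (Exec.assign s x e) he₂, by omega, hq₂⟩

theorem Runs.store_seq {a : ℕ} {e₁ e₂ : Expr}
    (h : Runs q (s.setArr a (e₁.eval s) (e₂.eval s)) T₂ Q)
    (hT : e₁.cost + e₂.cost + 1 + T₂ ≤ T) : Runs (.seq (.store a e₁ e₂) q) s T Q := by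
  obtain ⟨s₂, T₂', he₂, hT₂, hq₂⟩ := h
  exact ⟨s₂, _, Exec.seq (Exec.store s a e₁ e₂) he₂, by omega, hq₂⟩

theorem Runs.branch {e : Expr} (hp : e.eval s ≠ 0 → Runs p s T₁ Q)
    (hq : e.eval s = 0 → Runs q s T₁ Q) (hT : e.cost + 1 + T₁ ≤ T) :
    Runs (.branch e p q) s T Q := by
  by_cases h : e.eval s = 0
  · obtain ⟨s', T', he, hT', hQ⟩ := hq h
    exact ⟨s', _, Exec.branchFalse h he, by omega, hQ⟩
  · obtain ⟨s', T', he, hT', hQ⟩ := hp h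
    exact ⟨s', _, Exec.branchTrue h he, by omega, hQ⟩

/-- A loop that is entered with the loop variant `N` and decreases it. -/
theorem Runs.loop {e : Expr} (I : ℕ → State → Prop) {N : ℕ} (h₀ : I N s)
    (hpos : ∀ j s₁, I j s₁ → e.eval s₁ ≠ 0 → 0 < j)
    (hstep : ∀ j s₁, I (j + 1) s₁ → e.eval s₁ ≠ 0 → Runs p s₁ T (I j)) :
    Runs (.loop e p) s (N * (e.cost + 1 + T) + (e.cost + 1))
      (fun s' => e.eval s' = 0 ∧ ∃ j, I j s') := by
  induction N generalizing s with
  | zero =>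
    by_cases h : e.eval s = 0
    · exact ⟨s, _, Exec.loopFalse h, by omega, h, 0, h₀⟩
    · exact absurd (hpos 0 s h₀ h) (lt_irrefl 0)
  | succ N ih =>
    by_cases h : e.eval s = 0
    · exact ⟨s, _, Exec.loopFalse h, by omega, h, _, h₀⟩
    · obtain ⟨s₁, T₁, he₁, hT₁, hI⟩ := hstep N s h₀ h
      obtain ⟨s₂, T₂, he₂, hT₂, hQ⟩ := ih hI
      refine ⟨s₂, _, Exec.loopTrue h he₁ he₂, ?_, hQ⟩
      rw [add_mul]
      omega

/-- Execute `p` for `i = 0, …, b - 1`, where `i` and `b` are registers. -/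
def Prog.forLoop (i b : ℕ) (p : Prog) : Prog :=
  .seq (.assign i (.const 0)) (.loop (.sub (.reg b) (.reg i))
    (.seq p (.assign i (.add (.reg i) (.const 1)))))

@[simp] theorem setReg_regs (s : State) (x v y : ℕ) :
    (s.setReg x v).regs y = if y = x then v else s.regs y := by
  simp [State.setReg, Function.update_apply]

@[simp] theorem setReg_arrs (s : State) (x v : ℕ) : (s.setReg x v).arrs = s.arrs := rfl

@[simp] theorem setArr_regs (s : State) (a i v : ℕ) : (s.setArr a i v).regs = s.regs := rfl

theorem setArr_arrs (s : State) (a i v b : ℕ) :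
    (s.setArr a i v).arrs b = if b = a then Function.update (s.arrs a) i v else s.arrs b := by
  simp only [State.setArr, Function.update_apply]

@[simp] theorem setArr_arrs_self (s : State) (a i v : ℕ) :
    (s.setArr a i v).arrs a = Function.update (s.arrs a) i v := by
  simp [State.setArr]

theorem setReg_frame {i b : ℕ} {s' : State} (v : ℕ) (h : Frame (.forLoop i b p) s s') :
    Frame (.forLoop i b p) s (s'.setReg i v) := by
  refine ⟨fun x hx => ?_, h.arrs⟩
  rw [setReg_regs, ← h.regs x hx, if_neg]
  rintro rfl
  simp [Prog.forLoop, Prog.regsOut] at hx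

theorem Frame.forLoop_trans {i b : ℕ} {s₁ s₂ : State} (h : Frame (.forLoop i b p) s s₁)
    (h' : Frame p s₁ s₂) : Frame (.forLoop i b p) s s₂ := by
  constructor
  · intro x hx
    rw [← h.regs x hx]
    refine h'.regs x fun h => hx ?_
    simp [Prog.forLoop, Prog.regsOut, h]
  · intro x hx
    rw [← h.arrs x hx]
    refine h'.arrs x fun h => hx ?_
    simp [Prog.forLoop, Prog.arrsOut, h]

/-- The invariant rule for bounded loops. -/
theorem Runs.forLoop {i b N : ℕ} (I : ℕ → State → Prop) (hi : i ∉ p.regsOut) (hb : b ∉ p.regsOut)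
    (hib : b ≠ i) (hN : s.regs b = N) (h₀ : I 0 (s.setReg i 0))
    (hstep : ∀ j < N, ∀ s₁, I j s₁ → s₁.regs i = j → Frame (.forLoop i b p) s s₁ →
      Runs p s₁ T (fun s₂ => Frame p s₁ s₂ → I (j + 1) (s₂.setReg i (j + 1)))) :
    Runs (.forLoop i b p) s (N * (T + 8) + 6) (I N) := by
  have hbout : b ∉ (Prog.forLoop i b p).regsOut := by
    simp [Prog.forLoop, Prog.regsOut, hb, hib]
  -- Each round costs 4 for the test, `T` for the body and 4 for the increment; the remaining 6 are
  -- the initialization and the final test. The variant is the number of rounds left.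
  have hloop := Runs.loop (s := s.setReg i 0) (p := .seq p (.assign i (.add (.reg i) (.const 1))))
    (e := .sub (.reg b) (.reg i)) (T := T + 4) (N := N)
    (fun j s₁ => ∃ l, l + j = N ∧ s₁.regs i = l ∧ I l s₁ ∧ Frame (.forLoop i b p) s s₁)
    ⟨0, by simp, by simp, h₀, setReg_frame 0 ⟨fun _ _ => rfl, fun _ _ => rfl⟩⟩
    (by
      rintro j s₁ ⟨l, hl, hli, -, hf⟩ he
      simp only [Expr.eval, hf.regs b hbout, hN, hli] at he
      omega)
    (by
      rintro j s₁ ⟨l, hl, hli, hI, hf⟩ -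
      refine Runs.seq (hstep l (by omega) s₁ hI hli hf) (T₂ := 4) ?_ le_rfl
      intro s₂ hI₂ hf₂
      refine Runs.assign ?_ (by simp [Expr.cost])
      have hi₂ : s₂.regs i = l := by rw [hf₂.regs i hi, hli]
      simp only [Expr.eval, hi₂]
      exact ⟨l + 1, by omega, by simp, hI₂ hf₂, setReg_frame _ (hf.forLoop_trans hf₂)⟩)
  refine Runs.assign_seq (T₂ := N * (T + 8) + 4) (hloop.mono ?_ ?_) (by simp [Expr.cost]; omega)
  · have : (Expr.sub (.reg b) (.reg i)).cost + 1 + (T + 4) = T + 8 := by simp [Expr.cost]; omega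
    rw [this]
    simp [Expr.cost]
  · rintro s' ⟨he, j, l, hl, hli, hI, hf⟩ -
    simp only [Expr.eval, hf.regs b hbout, hN, hli] at he
    obtain rfl : l = N := by omega
    exact hI

/-! ### Elementary programs -/

/-- Register `d` receives the product of the registers `a` and `b`, with `i` as counter. -/
def Prog.mul (d a b i : ℕ) : Prog :=
  .seq (.assign d (.const 0)) (.forLoop i b (.assign d (.add (.reg d) (.reg a))))

/-- The product is a repeated sum, so the time is linear in the value of the second factor. -/
theorem Runs.mul {d a b i : ℕ} (hda : a ≠ d) (hdb : b ≠ d) (hid : i ≠ d) (hia : a ≠ i)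
    (hib : b ≠ i) :
    Runs (.mul d a b i) s (s.regs b * 12 + 8) (fun s' => s'.regs d = s.regs a * s.regs b) := by
  refine Runs.assign_seq (T₂ := s.regs b * 12 + 6) ?_ (by simp [Expr.cost]; omega)
  refine Runs.forLoop (T := 4) (N := s.regs b) (fun j s' => s'.regs d = s.regs a * j ∧
    s'.regs a = s.regs a) (by simpa [Prog.regsOut]) (by simpa [Prog.regsOut]) hib (by simp [hdb])
    ?_ ?_ |>.mono le_rfl (fun s' h _ => h.1)
  · simp [Expr.eval, hia, hid.symm, hda]
  · rintro j hj s₁ ⟨h₁, h₂⟩ - -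
    refine Runs.assign ?_ (by simp [Expr.cost])
    intro _
    simp [Expr.eval, hid.symm, h₁, h₂, hda, hia, mul_add]

/-- The invariant rule for bounded loops that test a conjunction: register `c` is kept at `0` as
long as no violation has been found. -/
theorem Runs.checkLoop {i b c N : ℕ} (C : ℕ → Prop) (hi : i ∉ p.regsOut) (hb : b ∉ p.regsOut)
    (hib : b ≠ i) (hic : c ≠ i) (hN : s.regs b = N)
    (hstep : ∀ j < N, ∀ s₁, s₁.regs i = j → Frame (.forLoop i b p) s s₁ →
      Runs p s₁ T (fun s₂ => s₂.regs c = 0 ↔ s₁.regs c = 0 ∧ C j)) :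
    Runs (.forLoop i b p) s (N * (T + 8) + 6)
      (fun s' => s'.regs c = 0 ↔ s.regs c = 0 ∧ ∀ j < N, C j) := by
  refine Runs.forLoop (fun j s' => s'.regs c = 0 ↔ s.regs c = 0 ∧ ∀ l < j, C l) hi hb hib hN
    (by simp [hic]) ?_
  intro j hj s₁ h₁ hji hf
  refine (hstep j hj s₁ hji hf).mono le_rfl fun s₂ h₂ _ _ => ?_
  rw [setReg_regs, if_neg hic, h₂, h₁, and_assoc]
  refine and_congr_right fun _ =>
    ⟨fun h l hl => ?_, fun h => ⟨fun l hl => h l (by omega), h j (by omega)⟩⟩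
  rcases Nat.lt_succ_iff_lt_or_eq.1 hl with hl | rfl
  · exact h.1 l hl
  · exact h.2

/-- Cell `i` of array `a` receives `i` times the content of register `b`, for all `i` less than
that content; `i` and `c` are auxiliary registers. -/
def Prog.offsets (a b i c : ℕ) : Prog :=
  .seq (.assign c (.const 0)) (.forLoop i b
    (.seq (.store a (.reg i) (.reg c)) (.assign c (.add (.reg c) (.reg b)))))

/-- A running sum replaces the products. With the row starts tabulated, one look-up in a row-major
matrix has constant cost. -/
theorem Runs.offsets {a b i c : ℕ} (hbc : b ≠ c) (hic : i ≠ c) (hbi : b ≠ i) :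
    Runs (.offsets a b i c) s (s.regs b * 15 + 8)
      (fun s' => ∀ u < s.regs b, s'.arrs a u = u * s.regs b) := by
  refine Runs.assign_seq (T₂ := s.regs b * 15 + 6) ?_ (by simp [Expr.cost]; omega)
  refine Runs.forLoop (T := 7) (N := s.regs b) (fun j s' => s'.regs c = j * s.regs b ∧
    s'.regs b = s.regs b ∧ ∀ u < j, s'.arrs a u = u * s.regs b) (by simpa [Prog.regsOut])
    (by simpa [Prog.regsOut]) hbi (by simp [hbc]) ?_ ?_ |>.mono le_rfl (fun s' h _ => h.2.2)
  · simp [Expr.eval, hbc, hic.symm, hbi]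
  · rintro j hj s₁ ⟨h₁, h₂, h₃⟩ hji -
    refine Runs.store_seq (T₂ := 4) (Runs.assign ?_ (by simp [Expr.cost])) (by simp [Expr.cost])
    intro _
    refine ⟨?_, ?_, fun u hu => ?_⟩
    · simp [Expr.eval, hic.symm, h₁, h₂, add_mul]
    · simp [Expr.eval, hbc, h₂, hbi]
    · simp only [Expr.eval, setReg_arrs, setArr_arrs_self, Function.update_apply, hji, h₁]
      split_ifs with h
      · rw [h]
      · exact h₃ u (by omega)

/-- The list of the first `c` values of `f`. -/
def listOf (f : ℕ → ℕ) (c : ℕ) : List ℕ := (List.range c).map f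

@[simp] theorem listOf_zero (f : ℕ → ℕ) : listOf f 0 = [] := rfl

@[simp] theorem length_listOf (f : ℕ → ℕ) (c : ℕ) : (listOf f c).length = c := by simp [listOf]

@[simp] theorem getElem_listOf (f : ℕ → ℕ) (c i : ℕ) (h : i < (listOf f c).length) :
    (listOf f c)[i] = f i := by simp [listOf]

theorem listOf_succ (f : ℕ → ℕ) (c : ℕ) : listOf f (c + 1) = listOf f c ++ [f c] := by
  simp [listOf, List.range_succ]

theorem listOf_congr {f g : ℕ → ℕ} {c : ℕ} (h : ∀ i < c, f i = g i) : listOf f c = listOf g c :=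
  List.map_congr_left fun i hi => h i (List.mem_range.1 hi)

theorem listOf_update (f : ℕ → ℕ) (c v : ℕ) :
    listOf (Function.update f c v) (c + 1) = listOf f c ++ [v] := by
  rw [listOf_succ, Function.update_self]
  congr 1
  exact listOf_congr fun i hi => Function.update_of_ne hi.ne _ _

/-- In the marking phase this recovers the list of high-degree vertices as a prefix of array `2`
after a closed neighborhood has been appended. -/
theorem listOf_length_of_eq_append {f : ℕ → ℕ} {c : ℕ} {l l' : List ℕ} (h : listOf f c = l ++ l') :
    listOf f l.length = l := by
  refine List.ext_getElem (by simp) fun i h₁ h₂ => ?_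
  have hc : i < (listOf f c).length := by rw [h, List.length_append]; omega
  have := List.getElem_of_eq h hc
  rw [List.getElem_append_left h₂] at this
  simpa using this

end RAM

/-! ### Types of vertices -/

section Types

variable (H : SimpleGraph ℕ) [DecidableRel H.Adj] (n : ℕ)

/-- The neighbors of `v` among `0, …, n - 1`. -/
def nbrs (v : ℕ) : List ℕ := (List.range n).filter fun w => H.Adj v w

/-- The vertices of degree at least `M`. -/
def highs (M : ℕ) : List ℕ := (List.range n).filter fun v => M ≤ (nbrs H n v).length

/-- The numbers with base-4 expansion `1, d₁, …, dₘ`. -/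
def encode (l : List ℕ) : ℕ := l.foldl (fun c d => 4 * c + d) 1

/-- Adjacency and equality of two vertices as a base-4 digit. -/
def pairDigit (a b : ℕ) : ℕ := 2 * (if H.Adj a b then 1 else 0) + (if a = b then 1 else 0)

/-- The isomorphism type of a list of vertices, as a number. -/
def listCode (l : List ℕ) : ℕ := encode (l.flatMap fun a => l.map fun b => pairDigit H a b)

/-- The list `A` followed by the closed neighborhood of `v`. -/
def starList (A : List ℕ) (v : ℕ) : List ℕ := A ++ v :: nbrs H n v

variable {H n}

theorem mem_nbrs {v w : ℕ} : w ∈ nbrs H n v ↔ w < n ∧ H.Adj v w := by simp [nbrs]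

theorem encode_append_singleton (l : List ℕ) (d : ℕ) : encode (l ++ [d]) = 4 * encode l + d := by
  simp [encode]

theorem encode_pos (l : List ℕ) : 0 < encode l := by
  induction l using List.reverseRecOn with
  | nil => simp [encode]
  | append_singleton l d ih => rw [encode_append_singleton]; omega

/-- The last digit is the residue modulo 4, so digits can be peeled off from the end. The leading 1
in the encoding keeps lists that differ only in leading zeros apart. -/
theorem encode_injective {l l' : List ℕ} (hl : ∀ d ∈ l, d < 4) (hl' : ∀ d ∈ l', d < 4)
    (h : encode l = encode l') : l = l' := by
  induction l using List.reverseRecOn generalizing l' with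
  | nil =>
    induction l' using List.reverseRecOn with
    | nil => rfl
    | append_singleton l' d' _ =>
      rw [encode_append_singleton] at h
      have := encode_pos l'
      simp only [encode, List.foldl_nil] at h this
      omega
  | append_singleton l d ih =>
    induction l' using List.reverseRecOn with
    | nil =>
      rw [encode_append_singleton] at h
      have := encode_pos l
      simp only [encode, List.foldl_nil] at h this
      omega
    | append_singleton l' d' _ =>
      rw [encode_append_singleton, encode_append_singleton] at h
      have h₁ := hl d (by simp)
      have h₂ := hl' d' (by simp)
      have h₃ : d = d' := by omega
      rw [h₃, ih (fun d hd => hl d (by simp [hd])) (fun d hd => hl' d (by simp [hd]))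
        (by omega : encode l = encode l')]

theorem encode_lt {l : List ℕ} (hl : ∀ d ∈ l, d < 4) : encode l < 2 * 4 ^ l.length := by
  induction l using List.reverseRecOn with
  | nil => simp [encode]
  | append_singleton l d ih =>
    have h₁ := ih fun d hd => hl d (by simp [hd])
    have h₂ := hl d (by simp)
    rw [encode_append_singleton, List.length_append, List.length_singleton, pow_succ]
    omega

theorem pairDigit_lt (a b : ℕ) : pairDigit H a b < 4 := by
  unfold pairDigit; split_ifs <;> omega

theorem pairDigit_eq_iff {a b a' b' : ℕ} (h : pairDigit H a b = pairDigit H a' b') :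
    (H.Adj a b ↔ H.Adj a' b') ∧ (a = b ↔ a' = b') := by
  unfold pairDigit at h
  split_ifs at h <;> simp_all

theorem lt_four_of_mem_flatMap_pairDigit {l : List ℕ} :
    ∀ d ∈ l.flatMap (fun a => l.map fun b => pairDigit H a b), d < 4 := by
  intro d hd
  simp only [List.mem_flatMap, List.mem_map] at hd
  obtain ⟨a, -, b, -, rfl⟩ := hd
  exact pairDigit_lt a b

theorem listCode_lt (l : List ℕ) : listCode H l < 2 * 4 ^ (l.length * l.length) := by
  refine (encode_lt lt_four_of_mem_flatMap_pairDigit).trans_eq ?_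
  simp [List.length_flatMap]

/-- The number of digits is the square of the length and so determines it; once the row lengths
agree, the flattened table of pairs splits uniquely into rows. -/
theorem listCode_eq {l l' : List ℕ} (h : listCode H l = listCode H l') :
    l.length = l'.length ∧ ∀ (p q : ℕ) (hp : p < l.length) (hq : q < l.length)
      (hp' : p < l'.length) (hq' : q < l'.length),
      (H.Adj l[p] l[q] ↔ H.Adj l'[p] l'[q]) ∧ (l[p] = l[q] ↔ l'[p] = l'[q]) := by
  have h₁ := encode_injective lt_four_of_mem_flatMap_pairDigit lt_four_of_mem_flatMap_pairDigit h
  have h₂ : l.length = l'.length := by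
    have := congrArg List.length h₁
    simp only [List.length_flatMap, List.length_map, List.map_const', List.sum_replicate,
      smul_eq_mul] at this
    exact Nat.mul_self_inj.1 this
  refine ⟨h₂, fun p q hp hq hp' hq' => pairDigit_eq_iff ?_⟩
  rw [List.flatMap, List.flatMap] at h₁
  have h₃ := List.eq_iff_flatten_eq.2 ⟨h₁, by
    simp only [List.map_map, Function.comp_def, List.length_map, List.map_const', h₂]⟩
  have h₄ := List.getElem_of_eq h₃ (i := p) (by simpa)
  simp only [List.getElem_map] at h₄
  have h₅ := List.getElem_of_eq h₄ (i := q) (by simpa)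
  simpa using h₅

/-- Vertices with the same code are locally isomorphic. -/
theorem localIso_of_listCode_eq (hH : ∀ v w, H.Adj v w → w < n) {A : List ℕ} {u v : ℕ}
    (h : listCode H (starList H n A u) = listCode H (starList H n A v)) :
    LocalIso H A.toFinset u v := by
  obtain ⟨hlen, hpq⟩ := listCode_eq h
  set Z := starList H n A u with hZ
  set Z' := starList H n A v with hZ'
  have hmem : ∀ y, (y ∈ A.toFinset ∨ y = u ∨ H.Adj u y) → y ∈ Z := by
    rintro y (hy | hy | hy)
    · simp [hZ, starList, List.mem_toFinset.1 hy]
    · simp [hZ, starList, hy]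
    · simp [hZ, starList, mem_nbrs, hy, hH _ _ hy]
  set φ : ℕ → ℕ := fun y => Z'.getD (Z.idxOf y) 0 with hφ
  -- The lists may repeat vertices, as `A` can meet the closed neighborhood, and `idxOf` finds the
  -- first occurrence. Equal codes mean equal patterns of repetition, so the choice of occurrence
  -- does not matter.
  have key : ∀ (p : ℕ) (hp : p < Z.length) (hp' : p < Z'.length), φ Z[p] = Z'[p] := by
    intro p hp hp'
    have h₁ : Z.idxOf Z[p] < Z.length := List.idxOf_lt_length_iff.2 (List.getElem_mem hp)
    have h₂ : Z.idxOf Z[p] < Z'.length := hlen ▸ h₁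
    have h₃ := (hpq _ p h₁ hp h₂ hp').2.1 (List.getElem_idxOf h₁)
    simp only [hφ]
    rw [List.getD_eq_getElem _ _ h₂, h₃]
  refine ⟨φ, fun a ha => ?_, ?_, fun y y' hy hy' => ?_⟩
  · obtain ⟨p, hp, rfl⟩ := List.getElem_of_mem (List.mem_toFinset.1 ha)
    have h₁ : p < Z.length := by simp [hZ, starList]; omega
    have := key p h₁ (hlen ▸ h₁)
    simpa [hZ, hZ', starList, List.getElem_append_left, hp] using this
  · have h₁ : A.length < Z.length := by simp [hZ, starList]
    have := key A.length h₁ (hlen ▸ h₁)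
    simpa [hZ, hZ', starList] using this
  · obtain ⟨p, hp, rfl⟩ := List.getElem_of_mem (hmem y hy)
    obtain ⟨q, hq, rfl⟩ := List.getElem_of_mem (hmem y' hy')
    rw [key p hp (hlen ▸ hp), key q hq (hlen ▸ hq)]
    have := hpq p q hp hq (hlen ▸ hp) (hlen ▸ hq)
    exact ⟨this.1.symm, this.2.symm⟩

end Types

/-! ### Programs on graphs

The registers `0, …, 7` hold the number `n` of vertices, the parameters `k` and `t`, the degree
threshold, the number of vertices to be marked of each type, `k * k`, the number of vertices of
high degree, and the length of the list of candidates; the registers from `8` on are auxiliary. The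
arrays hold `0`: the adjacency matrix, `1`: the multiples of `n`, `2`: the vertices of high degree,
followed by a closed neighborhood, `3`: the number of marked vertices of each type, `4`: the
candidates, `5`: the multiples of `k`, `6`: a system of representatives. -/

namespace RAM

variable {H : SimpleGraph ℕ} [DecidableRel H.Adj] {n : ℕ} {s s' : State} {p : Prog}

/-- Register `0` holds the number of vertices, array `0` the adjacency matrix, and array `1` the
positions at which its rows start. -/
structure HoldsGraph (H : SimpleGraph ℕ) [DecidableRel H.Adj] (n : ℕ) (s : State) : Prop where
  size : s.regs 0 = n
  row : ∀ u < n, s.arrs 1 u = u * n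
  entry : ∀ u < n, ∀ v < n, s.arrs 0 (u * n + v) = if H.Adj u v then 1 else 0

theorem HoldsGraph.of_eq (h : HoldsGraph H n s) (h₀ : s'.regs 0 = s.regs 0)
    (h₁ : s'.arrs 0 = s.arrs 0) (h₂ : s'.arrs 1 = s.arrs 1) : HoldsGraph H n s' :=
  ⟨h₀ ▸ h.size, h₂ ▸ h.row, h₁ ▸ h.entry⟩

theorem HoldsGraph.frame (h : HoldsGraph H n s) (hf : Frame p s s') (h₀ : 0 ∉ p.regsOut)
    (h₁ : 0 ∉ p.arrsOut ∧ 1 ∉ p.arrsOut) : HoldsGraph H n s' :=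
  h.of_eq (hf.regs 0 h₀) (hf.arrs 0 h₁.1) (hf.arrs 1 h₁.2)

/-- Adjacency of two vertices. -/
def Expr.adj (e₁ e₂ : Expr) : Expr := .load 0 (.add (.load 1 e₁) e₂)

/-- Equality of two numbers. -/
def Expr.eq (e₁ e₂ : Expr) : Expr := .sub (.const 1) (.add (.sub e₁ e₂) (.sub e₂ e₁))

theorem HoldsGraph.eval_adj (h : HoldsGraph H n s) {e₁ e₂ : Expr} (h₁ : e₁.eval s < n)
    (h₂ : e₂.eval s < n) :
    (Expr.adj e₁ e₂).eval s = if H.Adj (e₁.eval s) (e₂.eval s) then 1 else 0 := by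
  rw [← h.entry _ h₁ _ h₂, ← h.row _ h₁]
  rfl

/-- At least one of the two truncated differences vanishes, so their sum is zero exactly for equal
values. -/
theorem eval_eq (s : State) (e₁ e₂ : Expr) :
    (Expr.eq e₁ e₂).eval s = if e₁.eval s = e₂.eval s then 1 else 0 := by
  simp only [Expr.eq, Expr.eval]
  split_ifs <;> omega

/-- Register `9` receives the degree of the vertex in register `8`. -/
def Prog.degree : Prog :=
  .seq (.assign 9 (.const 0))
    (.forLoop 10 0 (.assign 9 (.add (.reg 9) (.adj (.reg 8) (.reg 10)))))

theorem Runs.degree (h : HoldsGraph H n s) (hv : s.regs 8 < n) :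
    Runs .degree s (n * 16 + 8) (fun s' => s'.regs 9 = (nbrs H n (s.regs 8)).length) := by
  refine Runs.assign_seq (T₂ := n * 16 + 6) ?_ (by simp [Expr.cost]; omega)
  refine Runs.forLoop (T := 8) (N := n) (fun j s' =>
    s'.regs 9 = ((List.range j).filter fun w => H.Adj (s.regs 8) w).length)
    (by decide) (by decide) (by decide) (by simp [h.size]) (by simp [Expr.eval]) ?_
  intro j hj s₁ h₁ hj₁ hf
  refine Runs.assign ?_ (by simp [Expr.cost, Expr.adj])
  intro _
  have h₈ : s₁.regs 8 = s.regs 8 := hf.regs 8 (by decide)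
  have hg : HoldsGraph H n s₁ := (h.of_eq (s' := s.setReg 9 _) rfl rfl rfl).frame hf (by decide)
    (by decide)
  have he := hg.eval_adj (e₁ := .reg 8) (e₂ := .reg 10) (by simpa [Expr.eval, h₈] using hv)
    (by simpa [Expr.eval, hj₁] using hj)
  simp only [Expr.eval, h₈, hj₁] at he
  rw [List.range_succ, List.filter_append, List.length_append, ← h₁]
  simp only [setReg_regs, Expr.eval, he]
  by_cases ha : H.Adj (s.regs 8) j <;> simp [ha]

/-- The vertices whose degree is at least the content of register `3` are written into the
arrays `2` and `4`, their number into register `6`. -/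
def Prog.highs : Prog :=
  .seq (.assign 6 (.const 0)) (.forLoop 8 0 (.seq .degree
    (.branch (.sub (.reg 3) (.reg 9)) .skip
      (.seq (.store 2 (.reg 6) (.reg 8)) (.seq (.store 4 (.reg 6) (.reg 8))
        (.assign 6 (.add (.reg 6) (.const 1))))))))

theorem Runs.highs (h : HoldsGraph H n s) :
    Runs .highs s (n * (n * 16 + 22 + 8) + 8) (fun s' =>
      listOf (s'.arrs 2) (s'.regs 6) = highs H n (s.regs 3) ∧
      listOf (s'.arrs 4) (s'.regs 6) = highs H n (s.regs 3)) := by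
  refine Runs.assign_seq (T₂ := n * (n * 16 + 22 + 8) + 6) ?_ (by simp [Expr.cost]; omega)
  refine Runs.forLoop (T := n * 16 + 22) (N := n) (fun j s' =>
    listOf (s'.arrs 2) (s'.regs 6) =
      ((List.range j).filter fun v => s.regs 3 ≤ (nbrs H n v).length) ∧
    listOf (s'.arrs 4) (s'.regs 6) =
      ((List.range j).filter fun v => s.regs 3 ≤ (nbrs H n v).length))
    (by decide) (by decide) (by decide) (by simp [h.size]) (by simp [Expr.eval]) ?_
  rintro j hj s₁ ⟨h₁, h₂⟩ hj₁ hf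
  have hg : HoldsGraph H n s₁ := (h.of_eq (s' := s.setReg 6 _) rfl rfl rfl).frame hf (by decide)
    (by decide)
  refine Runs.seq (T₂ := 14) (Runs.degree hg (by omega)) ?_ (by omega)
  intro s₂ h₉ hf₂
  have h₃ : s₂.regs 3 = s.regs 3 := by rw [hf₂.regs 3 (by decide), hf.regs 3 (by decide)]; rfl
  have h₆ : s₂.regs 6 = s₁.regs 6 := hf₂.regs 6 (by decide)
  have h₈ : s₂.regs 8 = j := by rw [hf₂.regs 8 (by decide), hj₁]
  have a₂ : s₂.arrs 2 = s₁.arrs 2 := hf₂.arrs 2 (by decide)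
  have a₄ : s₂.arrs 4 = s₁.arrs 4 := hf₂.arrs 4 (by decide)
  rw [hj₁] at h₉
  rw [List.range_succ, List.filter_append]
  refine Runs.branch (T₁ := 10) (fun he => Runs.skip ?_ (by omega)) (fun he => ?_)
    (by simp [Expr.cost])
  · intro _
    simp only [Expr.eval, h₃, h₉] at he
    have : ¬ s.regs 3 ≤ (nbrs H n j).length := by omega
    simp [this, a₂, a₄, h₆, h₁, h₂]
  · refine Runs.store_seq (T₂ := 7) (Runs.store_seq (T₂ := 4) (Runs.assign ?_
      (by simp [Expr.cost])) (by simp [Expr.cost])) (by simp [Expr.cost])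
    intro _
    simp only [Expr.eval, h₃, h₉] at he
    have : s.regs 3 ≤ (nbrs H n j).length := by omega
    simp [this, Expr.eval, setArr_arrs, a₂, a₄, h₆, h₈, listOf_update, h₁, h₂]

/-- The vertex in register `8` and its neighbors are appended to the list of length register `6`
in array `2`; register `9` receives the new length. -/
def Prog.star : Prog :=
  .seq (.store 2 (.reg 6) (.reg 8)) (.seq (.assign 9 (.add (.reg 6) (.const 1)))
    (.forLoop 10 0 (.branch (.adj (.reg 8) (.reg 10))
      (.seq (.store 2 (.reg 9) (.reg 10)) (.assign 9 (.add (.reg 9) (.const 1)))) .skip)))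

theorem Runs.star (h : HoldsGraph H n s) (hv : s.regs 8 < n) :
    Runs .star s (n * 21 + 13) (fun s' => listOf (s'.arrs 2) (s'.regs 9) =
      starList H n (listOf (s.arrs 2) (s.regs 6)) (s.regs 8)) := by
  refine Runs.store_seq (T₂ := n * 21 + 10) (Runs.assign_seq (T₂ := n * 21 + 6) ?_
    (by simp [Expr.cost]; omega)) (by simp [Expr.cost]; omega)
  refine Runs.forLoop (T := 13) (N := n) (fun j s' => listOf (s'.arrs 2) (s'.regs 9) =
    listOf (s.arrs 2) (s.regs 6) ++ s.regs 8 :: (List.range j).filter fun w => H.Adj (s.regs 8) w)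
    (by decide) (by decide) (by decide) (by simp [h.size])
    (by simp [Expr.eval, listOf_update]) ?_
  intro j hj s₁ h₁ hj₁ hf
  have h₈ : s₁.regs 8 = s.regs 8 := hf.regs 8 (by decide)
  have hg : HoldsGraph H n s₁ := h.of_eq (hf.regs 0 (by decide)) (hf.arrs 0 (by decide))
    (hf.arrs 1 (by decide))
  have he := hg.eval_adj (e₁ := .reg 8) (e₂ := .reg 10) (by simpa [Expr.eval, h₈] using hv)
    (by simpa [Expr.eval, hj₁] using hj)
  simp only [Expr.eval, h₈, hj₁] at he
  refine Runs.branch (T₁ := 7) (fun hne => ?_) (fun h0 => Runs.skip ?_ (by omega))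
    (by simp [Expr.cost, Expr.adj])
  · have ha : H.Adj (s.regs 8) j := by
      by_contra ha
      exact hne (by rw [he, if_neg ha])
    refine Runs.store_seq (T₂ := 4) (Runs.assign ?_ (by simp [Expr.cost])) (by simp [Expr.cost])
    intro _
    simp [List.range_succ, ha, Expr.eval, hj₁, listOf_update, h₁]
  · have ha : ¬ H.Adj (s.regs 8) j := by
      intro ha
      rw [he, if_pos ha] at h0
      exact one_ne_zero h0
    intro _
    simp [List.range_succ, ha, h₁]

/-- Register `11` receives the code of the list of length register `9` in array `2`. -/
def Prog.code : Prog :=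
  .seq (.assign 11 (.const 1)) (.forLoop 12 9 (.forLoop 13 9
    (.assign 11 (.add (.add (.add (.reg 11) (.reg 11)) (.add (.reg 11) (.reg 11)))
      (.add (.add (.adj (.load 2 (.reg 12)) (.load 2 (.reg 13)))
        (.adj (.load 2 (.reg 12)) (.load 2 (.reg 13))))
        (.eq (.load 2 (.reg 12)) (.load 2 (.reg 13))))))))

theorem Runs.code (h : HoldsGraph H n s) (hlt : ∀ i < s.regs 9, s.arrs 2 i < n) :
    Runs .code s (s.regs 9 * (s.regs 9 * 58 + 14) + 8)
      (fun s' => s'.regs 11 = listCode H (listOf (s.arrs 2) (s.regs 9))) := by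
  set z := s.regs 9 with hz
  set f := s.arrs 2 with hf₀
  refine Runs.assign_seq (T₂ := z * (z * 58 + 14) + 6) ?_ (by simp [Expr.cost]; omega)
  refine Runs.forLoop (T := z * 58 + 6) (N := z) (fun p s' => s'.regs 11 =
    encode ((listOf f p).flatMap fun a => (listOf f z).map fun b => pairDigit H a b))
    (by decide) (by decide) (by decide) (by simp [hz]) (by simp [Expr.eval, encode]) ?_
  intro p hp s₁ h₁ hp₁ hf
  -- The outer loop appends rows of the pair table, the inner loop single digits; multiplication by
  -- 4 is done by additions.
  refine (Runs.forLoop (T := 50) (N := z) (fun q s' => s'.regs 11 =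
    encode (((listOf f p).flatMap fun a => (listOf f z).map fun b => pairDigit H a b) ++
      (listOf f q).map fun b => pairDigit H (f p) b))
    (by decide) (by decide) (by decide) (by simp [hf.regs 9 (by decide), hz])
    (by simp [h₁]) ?_).mono le_rfl ?_
  · intro q hq s₂ h₂ hq₂ hf₂
    refine Runs.assign ?_ (by simp [Expr.cost, Expr.adj, Expr.eq])
    intro _
    have hg : HoldsGraph H n s₂ := h.of_eq
      (by rw [hf₂.regs 0 (by decide), hf.regs 0 (by decide)]; rfl)
      (by rw [hf₂.arrs 0 (by decide), hf.arrs 0 (by decide)]; rfl)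
      (by rw [hf₂.arrs 1 (by decide), hf.arrs 1 (by decide)]; rfl)
    have hp₂ : s₂.regs 12 = p := by rw [hf₂.regs 12 (by decide), hp₁]
    have ha₂ : s₂.arrs 2 = f := by rw [hf₂.arrs 2 (by decide), hf.arrs 2 (by decide)]; rfl
    have he := hg.eval_adj (e₁ := .load 2 (.reg 12)) (e₂ := .load 2 (.reg 13))
      (by simpa [Expr.eval, ha₂, hp₂] using hlt p hp)
      (by simpa [Expr.eval, ha₂, hq₂] using hlt q hq)
    have he' := eval_eq s₂ (.load 2 (.reg 12)) (.load 2 (.reg 13))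
    simp only [Expr.eval, ha₂, hp₂, hq₂] at he he'
    rw [listOf_succ, List.map_append, ← List.append_assoc, List.map_singleton,
      encode_append_singleton, ← h₂]
    simp only [setReg_regs, Expr.eval, he, he', pairDigit]
    simp only [show (11 : ℕ) ≠ 13 by decide, if_true, if_false]
    omega
  · intro s' hs _ _
    rw [listOf_succ, List.flatMap_append]
    simpa using hs

/-- The list of length register `9` in array `2` is appended to the list of length register `7`
in array `4`. -/
def Prog.append : Prog :=
  .forLoop 12 9 (.seq (.store 4 (.reg 7) (.load 2 (.reg 12)))
    (.assign 7 (.add (.reg 7) (.const 1))))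

theorem Runs.append (s : State) :
    Runs .append s (s.regs 9 * 16 + 6) (fun s' => listOf (s'.arrs 4) (s'.regs 7) =
      listOf (s.arrs 4) (s.regs 7) ++ listOf (s.arrs 2) (s.regs 9)) := by
  refine Runs.forLoop (T := 8) (N := s.regs 9) (fun j s' => listOf (s'.arrs 4) (s'.regs 7) =
    listOf (s.arrs 4) (s.regs 7) ++ listOf (s.arrs 2) j)
    (by decide) (by decide) (by decide) rfl (by simp) ?_
  intro j hj s₁ h₁ hj₁ hf
  refine Runs.store_seq (T₂ := 4) (Runs.assign ?_ (by simp [Expr.cost])) (by simp [Expr.cost])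
  intro _
  have ha : s₁.arrs 2 = s.arrs 2 := hf.arrs 2 (by decide)
  rw [listOf_succ (s.arrs 2)]
  simp [Expr.eval, hj₁, listOf_update, h₁, ha]

end RAM

/-! ### Marking representatives of all types -/

section Marking

variable (H : SimpleGraph ℕ) [DecidableRel H.Adj] (n : ℕ) (A : List ℕ) (M N : ℕ)

/-- The set `Mk` consists of vertices `u < j` of degree less than `M`, at most `N` of each type, and
contains `N` vertices of the type of every other such `u`. Here `cnt` counts the vertices of `Mk`
of each type, and the list `W` contains `A` and the closed neighborhoods of the vertices
in `Mk`. -/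
structure Marked (j : ℕ) (Mk : Finset ℕ) (cnt : ℕ → ℕ) (W : List ℕ) : Prop where
  low : ∀ u ∈ Mk, u < j ∧ (nbrs H n u).length < M
  count : ∀ c, cnt c = (Mk.filter fun u => listCode H (starList H n A u) = c).card
  count_le : ∀ c, cnt c ≤ N
  full : ∀ u < j, (nbrs H n u).length < M → u ∉ Mk → N ≤ cnt (listCode H (starList H n A u))
  lt : ∀ y ∈ W, y < n
  high : ∀ a ∈ A, a ∈ W
  nbr : ∀ u ∈ Mk, ∀ y ∈ u :: nbrs H n u, y ∈ W
  length_le : W.length ≤ A.length + Mk.card * (A.length + M)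

variable {H n A M N} {j : ℕ} {Mk : Finset ℕ} {cnt : ℕ → ℕ} {W : List ℕ}

theorem Marked.zero (hA : ∀ a ∈ A, a < n) : Marked H n A M N 0 ∅ (fun _ => 0) A :=
  ⟨by simp, by simp, by simp, by simp, hA, fun _ h => h, by simp, by simp⟩

theorem Marked.succ_of_not_lt (h : Marked H n A M N j Mk cnt W)
    (hj : ¬ (nbrs H n j).length < M) : Marked H n A M N (j + 1) Mk cnt W :=
  { h with
    low := fun u hu => ⟨(h.low u hu).1.trans (Nat.lt_succ_self j), (h.low u hu).2⟩
    full := by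
      intro u hu hlow hu'
      rcases Nat.lt_succ_iff_lt_or_eq.1 hu with hu | rfl
      · exact h.full u hu hlow hu'
      · exact absurd hlow hj }

theorem Marked.succ_of_le (h : Marked H n A M N j Mk cnt W)
    (hj : N ≤ cnt (listCode H (starList H n A j))) : Marked H n A M N (j + 1) Mk cnt W :=
  { h with
    low := fun u hu => ⟨(h.low u hu).1.trans (Nat.lt_succ_self j), (h.low u hu).2⟩
    full := by
      intro u hu hlow hu'
      rcases Nat.lt_succ_iff_lt_or_eq.1 hu with hu | rfl
      · exact h.full u hu hlow hu'
      · exact hj }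

/-- The whole star list is appended, `A` included; this accounts for `A.length + M` entries per
marked vertex in the length bound. -/
theorem Marked.insert (h : Marked H n A M N j Mk cnt W) (hjn : j < n)
    (hlow : (nbrs H n j).length < M) (hA : ∀ a ∈ A, a < n)
    (hj : cnt (listCode H (starList H n A j)) < N) :
    Marked H n A M N (j + 1) (insert j Mk)
      (Function.update cnt (listCode H (starList H n A j))
        (cnt (listCode H (starList H n A j)) + 1)) (W ++ starList H n A j) := by
  have hjMk : j ∉ Mk := fun hj => (h.low j hj).1.false
  refine ⟨?_, ?_, ?_, ?_, ?_, ?_, ?_, ?_⟩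
  · intro u hu
    rcases Finset.mem_insert.1 hu with rfl | hu
    · exact ⟨Nat.lt_succ_self _, hlow⟩
    · exact ⟨(h.low u hu).1.trans (Nat.lt_succ_self j), (h.low u hu).2⟩
  · intro c
    rw [Finset.filter_insert]
    by_cases hc : listCode H (starList H n A j) = c
    · subst hc
      rw [Function.update_self, if_pos rfl, Finset.card_insert_of_notMem (by simp [hjMk]), h.count]
    · rw [Function.update_of_ne (Ne.symm hc), if_neg hc, h.count]
  · intro c
    rw [Function.update_apply]
    split_ifs
    · exact hj
    · exact h.count_le c
  · intro u hu hu' huMk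
    rw [Finset.mem_insert, not_or] at huMk
    have := h.full u (by omega) hu' huMk.2
    rw [Function.update_apply]
    split_ifs with hc
    · rw [← hc]; omega
    · exact this
  · intro y hy
    rcases List.mem_append.1 hy with hy | hy
    · exact h.lt y hy
    · simp only [starList, List.mem_append, List.mem_cons] at hy
      rcases hy with hy | rfl | hy
      · exact hA y hy
      · exact hjn
      · exact (mem_nbrs.1 hy).1
  · exact fun a ha => List.mem_append_left _ (h.high a ha)
  · intro u hu y hy
    rcases Finset.mem_insert.1 hu with rfl | hu
    · exact List.mem_append_right _ (List.mem_append_right _ hy)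
    · exact List.mem_append_left _ (h.nbr u hu y hy)
  · have := h.length_le
    rw [Finset.card_insert_of_notMem hjMk, List.length_append, add_mul]
    simp only [starList, List.length_append, List.length_cons]
    omega

/-- A bound for the number of listed vertices. -/
def listBound (M N : ℕ) : ℕ := M + N * (2 * 4 ^ ((M + M) * (M + M))) * (M + M)

/-- Star lists of marked vertices have length at most `M + M`, so their codes take fewer than `2 * 4
^ ((M + M) * (M + M))` values. Each value is attained by at most `N` marked vertices, and each of
these contributes at most `M + M` entries. -/
theorem Marked.length_le_listBound (h : Marked H n A M N j Mk cnt W) (hA : A.length ≤ M) :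
    W.length ≤ listBound M N := by
  have h₁ : Mk.card ≤ N * (Mk.image fun u => listCode H (starList H n A u)).card :=
    Finset.card_le_mul_card_image _ _ fun c _ => by
      rw [← h.count]; exact h.count_le c
  have h₂ : (Mk.image fun u => listCode H (starList H n A u)).card ≤
      2 * 4 ^ ((M + M) * (M + M)) := by
    rw [← Finset.card_range (2 * 4 ^ ((M + M) * (M + M)))]
    refine Finset.card_le_card fun c hc => ?_
    obtain ⟨u, hu, rfl⟩ := Finset.mem_image.1 hc
    refine Finset.mem_range.2 ((listCode_lt _).trans_le ?_)
    have h₃ : (starList H n A u).length ≤ M + M := by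
      have := (h.low u hu).2
      simp only [starList, List.length_append, List.length_cons]
      omega
    gcongr
    norm_num
  refine h.length_le.trans (Nat.add_le_add hA (Nat.mul_le_mul ?_ (by omega)))
  exact h₁.trans (Nat.mul_le_mul_left _ h₂)

/-- Systems of representatives can be found among the listed vertices. -/
theorem Marked.exists_isSystem {k : ℕ} {R : ℕ → ℕ → Prop} {x : ℕ → ℕ → ℕ}
    (hH : ∀ v w, H.Adj v w → v < n ∧ w < n) (h : Marked H n (highs H n M) M N n Mk cnt W)
    (hM : 0 < M) (hN : k * k * (M * M) < N) (hx : IsSystem H k R x)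
    (hxn : ∀ i < k, ∀ j < k, x i j < n) :
    ∃ x', IsSystem H k R x' ∧ ∀ i < k, ∀ j < k, x' i j ∈ W := by
  have hlow : ∀ v < n, v ∉ (highs H n M).toFinset → (nbrs H n v).length < M := by
    intro v hv hv'
    simpa [highs, hv] using hv'
  suffices ∃ x', IsSystem H k R x' ∧ ∀ i < k, ∀ j < k, x' i j ∈ W.toFinset by
    simpa only [List.mem_toFinset] using this
  -- The set `D` confines the exchange to vertices below `n`, the only ones that the marking phase
  -- examines.
  refine hx.exists_mem (A := (highs H n M).toFinset) (Mk := Mk)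
    (W := W.toFinset) (D := {v | v < n}) (nb := fun v => (v :: nbrs H n v).toFinset) (M := M)
    (N := k * k * (M * M)) ?_ ?_ ?_ le_rfl ?_ ?_ ?_ hxn
  · intro v y
    simp only [List.mem_toFinset, List.mem_cons, mem_nbrs]
    exact or_congr_right ⟨fun h => h.2, fun h => ⟨(hH _ _ h).2, h⟩⟩
  · intro v hv
    refine (List.toFinset_card_le _).trans ?_
    rw [List.length_cons]
    by_cases hvn : v < n
    · exact hlow v hvn hv
    · have : nbrs H n v = [] := by
        refine List.eq_nil_iff_forall_not_mem.2 fun y hy => hvn (hH _ _ (mem_nbrs.1 hy).2).1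
      rw [this, List.length_nil]
      omega
  · intro v hv hvA hvMk
    refine ⟨Mk.filter fun u => listCode H (starList H n (highs H n M) u) =
      listCode H (starList H n (highs H n M) v), Finset.filter_subset _ _, ?_, ?_⟩
    · rw [← h.count]
      exact hN.trans_le (h.full v hv (hlow v hv hvA) hvMk)
    · intro w hw
      exact localIso_of_listCode_eq (fun v w h => (hH v w h).2) (Finset.mem_filter.1 hw).2.symm
  · intro a ha
    exact List.mem_toFinset.2 (h.high a (List.mem_toFinset.1 ha))
  · intro v hv y hy
    exact List.mem_toFinset.2 (h.nbr v hv y (List.mem_toFinset.1 hy))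
  · intro v hv
    exact h.lt v (List.mem_toFinset.1 hv)

end Marking

/-! ### The marking program -/

namespace RAM

variable {H : SimpleGraph ℕ} [DecidableRel H.Adj] {n : ℕ} {s : State}

/-- Go through all vertices of degree less than register `3`, and mark at most register `4` of
each type. The marked vertices of each type are counted in array `3`, the neighborhoods of the
marked vertices are appended to array `4`. -/
def Prog.mark : Prog :=
  .seq (.assign 7 (.reg 6)) (.forLoop 8 0 (.seq .star
    (.branch (.sub (.add (.add (.reg 3) (.reg 6)) (.const 1)) (.reg 9))
      (.seq .code (.branch (.sub (.reg 4) (.load 3 (.reg 11)))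
        (.seq (.store 3 (.reg 11) (.add (.load 3 (.reg 11)) (.const 1))) .append) .skip))
      .skip)))

/-- The running time of `Prog.mark`. -/
def markTime (n d : ℕ) : ℕ := n * (n * 21 + d * (d * 58 + 14) + d * 16 + 60 + 8) + 8

/-- The list `A` must survive as a prefix of array `2`, where the star lists are built, so the
invariant carries it along. Vertices of high degree are skipped before encoding; hence, besides one
scan of a matrix row, the work per vertex depends only on `A.length` and the threshold. -/
theorem Runs.mark (h : HoldsGraph H n s) {A : List ℕ} (hA : ∀ a ∈ A, a < n)
    (h₂ : listOf (s.arrs 2) (s.regs 6) = A) (h₄ : listOf (s.arrs 4) (s.regs 6) = A)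
    (h₃ : s.arrs 3 = fun _ => 0) :
    Runs .mark s (markTime n (A.length + s.regs 3)) (fun s' => ∃ Mk,
      Marked H n A (s.regs 3) (s.regs 4) n Mk (s'.arrs 3) (listOf (s'.arrs 4) (s'.regs 7))) := by
  set M := s.regs 3 with hM
  set N := s.regs 4 with hN
  set d := A.length + M with hd
  have hAlen : s.regs 6 = A.length := by rw [← h₂, length_listOf]
  refine Runs.assign_seq (T₂ := n * (n * 21 + d * (d * 58 + 14) + d * 16 + 60 + 8) + 6) ?_
    (by simp [Expr.cost, markTime]; omega)
  refine (Runs.forLoop (T := n * 21 + d * (d * 58 + 14) + d * 16 + 60) (N := n) (fun j s' =>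
    listOf (s'.arrs 2) A.length = A ∧ ∃ Mk,
      Marked H n A M N j Mk (s'.arrs 3) (listOf (s'.arrs 4) (s'.regs 7)))
    (by decide) (by decide) (by decide) (by simp [h.size]) ?_ ?_).mono le_rfl fun s' h _ => h.2
  · refine ⟨by rw [← hAlen]; exact h₂, ∅, ?_⟩
    simp only [setReg_arrs, h₃]
    simpa [Expr.eval, h₄] using Marked.zero hA
  rintro j hj s₁ ⟨hA₁, Mk, hMk⟩ hj₁ hf
  have hg : HoldsGraph H n s₁ := h.of_eq (hf.regs 0 (by decide)) (hf.arrs 0 (by decide))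
    (hf.arrs 1 (by decide))
  have r₆ : s₁.regs 6 = A.length := by rw [hf.regs 6 (by decide), ← hAlen]; rfl
  refine Runs.seq (T₂ := d * (d * 58 + 14) + d * 16 + 47) (Runs.star hg (by omega)) ?_ (by omega)
  intro s₂ hs₂ hf₂
  rw [r₆, hA₁, hj₁] at hs₂
  have hg₂ : HoldsGraph H n s₂ := hg.frame hf₂ (by decide) (by decide)
  have r₃ : s₂.regs 3 = M := by rw [hf₂.regs 3 (by decide), hf.regs 3 (by decide)]; rfl
  have r₄ : s₂.regs 4 = N := by rw [hf₂.regs 4 (by decide), hf.regs 4 (by decide)]; rfl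
  have r₆₂ : s₂.regs 6 = A.length := by rw [hf₂.regs 6 (by decide), r₆]
  have r₇₂ : s₂.regs 7 = s₁.regs 7 := hf₂.regs 7 (by decide)
  have a₃₂ : s₂.arrs 3 = s₁.arrs 3 := hf₂.arrs 3 (by decide)
  have a₄₂ : s₂.arrs 4 = s₁.arrs 4 := hf₂.arrs 4 (by decide)
  have r₉ : s₂.regs 9 = A.length + ((nbrs H n j).length + 1) := by
    have := congrArg List.length hs₂
    simpa [starList] using this
  have hA₂ : listOf (s₂.arrs 2) A.length = A := listOf_length_of_eq_append hs₂
  rw [← a₃₂, ← a₄₂, ← r₇₂] at hMk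
  refine Runs.branch (T₁ := d * (d * 58 + 14) + d * 16 + 39) (fun he => ?_)
    (fun he => Runs.skip ?_ (by omega)) (by simp [Expr.cost]; omega)
  -- The test compares the star list's length, `A.length` plus the degree plus 1, with `M + A.length
  -- + 1`; it succeeds exactly if the degree is less than `M`.
  · simp only [Expr.eval, r₃, r₆₂, r₉] at he
    have hlow : (nbrs H n j).length < M := by omega
    have hzd : s₂.regs 9 ≤ d := by omega
    have hlt : ∀ i < s₂.regs 9, s₂.arrs 2 i < n := by
      intro i hi
      have : s₂.arrs 2 i ∈ starList H n A j := by
        rw [← hs₂]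
        exact List.mem_map_of_mem (List.mem_range.2 hi)
      simp only [starList, List.mem_append, List.mem_cons] at this
      rcases this with hy | hy | hy
      · exact hA _ hy
      · rw [hy]; exact hj
      · exact (mem_nbrs.1 hy).1
    have hz₁ : s₂.regs 9 * (s₂.regs 9 * 58 + 14) ≤ d * (d * 58 + 14) :=
      Nat.mul_le_mul hzd (by omega)
    refine Runs.seq (T₂ := d * 16 + 31) (Runs.code hg₂ hlt) ?_ (by omega)
    intro s₃ hs₃ hf₃
    rw [hs₂] at hs₃
    have r₄₃ : s₃.regs 4 = N := by rw [hf₃.regs 4 (by decide), r₄]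
    have r₇₃ : s₃.regs 7 = s₂.regs 7 := hf₃.regs 7 (by decide)
    have r₉₃ : s₃.regs 9 = s₂.regs 9 := hf₃.regs 9 (by decide)
    have a₂₃ : s₃.arrs 2 = s₂.arrs 2 := hf₃.arrs 2 (by decide)
    have a₃₃ : s₃.arrs 3 = s₂.arrs 3 := hf₃.arrs 3 (by decide)
    have a₄₃ : s₃.arrs 4 = s₂.arrs 4 := hf₃.arrs 4 (by decide)
    rw [← a₃₃, ← a₄₃, ← r₇₃] at hMk
    rw [← a₂₃] at hA₂
    refine Runs.branch (T₁ := d * 16 + 26) (fun he => ?_)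
      (fun he => Runs.skip ?_ (by omega)) (by simp [Expr.cost]; omega)
    · simp only [Expr.eval, r₄₃, hs₃] at he
      refine Runs.store_seq (T₂ := d * 16 + 6) ((Runs.append _).mono ?_ ?_)
        (by simp [Expr.cost]; omega)
      · simp only [setArr_regs]; omega
      · intro s₄ hs₄ hf₄ _
        simp only [setArr_regs, Expr.eval, setArr_arrs, hs₃] at hs₄
        simp only [show (4 : ℕ) ≠ 3 by decide, show (2 : ℕ) ≠ 3 by decide, if_false, r₉₃, a₂₃,
          hs₂] at hs₄
        have a₃₄ := hf₄.arrs 3 (by decide)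
        have a₂₄ := hf₄.arrs 2 (by decide)
        simp only [setArr_arrs, Expr.eval, hs₃, if_true] at a₃₄
        simp only [setArr_arrs, show (2 : ℕ) ≠ 3 by decide, if_false] at a₂₄
        refine ⟨by simp only [setReg_arrs, a₂₄, hA₂], insert j Mk, ?_⟩
        simp only [setReg_arrs, setReg_regs, show (7 : ℕ) ≠ 8 by decide, if_false, a₃₄, hs₄]
        exact hMk.insert hj hlow hA (by omega)
    · simp only [Expr.eval, r₄₃, hs₃] at he
      intro _
      exact ⟨hA₂, Mk, hMk.succ_of_le (by omega)⟩
  · simp only [Expr.eval, r₃, r₆₂, r₉] at he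
    intro _
    exact ⟨hA₂, Mk, hMk.succ_of_not_lt (by omega)⟩

end RAM

namespace RAM

variable {H : SimpleGraph ℕ} [DecidableRel H.Adj] {n : ℕ} {s : State}

/-! ### Thresholds -/

/-- Register `3` receives the degree threshold, and register `4` its fourth power. -/
def Prog.thresholds : Prog :=
  .seq (.assign 3 (.add (.add (.reg 5) (.reg 1)) (.add (.reg 2) (.const 2))))
    (.seq (.assign 10 (.add (.reg 5) (.const 1)))
      (.seq (.forLoop 11 10 (.seq (.mul 12 3 3 13) (.assign 3 (.reg 12))))
        (.seq (.mul 12 3 3 13) (.mul 4 12 12 13))))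

/-- The running time of `Prog.thresholds`. -/
def thresholdsTime (k M : ℕ) : ℕ := (k * k + 1) * (M * 12 + 18) + M * 12 + M * M * 12 + 34

theorem Runs.thresholds {k t : ℕ} (h₁ : s.regs 1 = k) (h₂ : s.regs 2 = t)
    (h₅ : s.regs 5 = k * k) :
    Runs .thresholds s (thresholdsTime k (threshold k t)) (fun s' =>
      s'.regs 3 = threshold k t ∧
      s'.regs 4 = (threshold k t * threshold k t) * (threshold k t * threshold k t)) := by
  set M := threshold k t with hM
  refine Runs.assign_seq (T₂ := (k * k + 1) * (M * 12 + 18) + M * 12 + M * M * 12 + 26) ?_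
    (by simp [Expr.cost, thresholdsTime]; omega)
  refine Runs.assign_seq (T₂ := (k * k + 1) * (M * 12 + 18) + M * 12 + M * M * 12 + 22) ?_
    (by simp [Expr.cost]; omega)
  refine Runs.seq (T₁ := (k * k + 1) * (M * 12 + 18) + 6) (T₂ := M * 12 + M * M * 12 + 16)
    (Runs.forLoop (T := M * 12 + 10) (N := k * k + 1)
      (fun j s' => s'.regs 3 = iterSq (k * k + k + t + 2) j)
      (by decide) (by decide) (by decide) (by simp [Expr.eval, h₅])
      (by simp [Expr.eval, h₁, h₂, h₅, iterSq]; omega) ?_) ?_ (by omega)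
  · intro j hj s₁ hs₁ _ _
    -- The iterated squares increase up to `M`, so `M` bounds the time of every multiplication in
    -- the loop.
    have hle : s₁.regs 3 ≤ M := hs₁ ▸ iterSq_mono _ hj.le
    refine Runs.seq (T₂ := 2) (Runs.mul (by decide) (by decide) (by decide) (by decide)
      (by decide)) ?_ (by omega)
    intro s₂ hs₂ _
    refine Runs.assign ?_ (by simp [Expr.cost])
    intro _
    simp [Expr.eval, hs₂, hs₁, iterSq]
  · intro s₁ hs₁ _
    replace hs₁ : s₁.regs 3 = M := hs₁
    refine Runs.seq (T₁ := M * 12 + 8) (T₂ := M * M * 12 + 8)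
      ((Runs.mul (by decide) (by decide) (by decide) (by decide) (by decide)).mono
        (by rw [hs₁]) fun s' h _ => h) ?_ (by omega)
    intro s₂ hs₂ hf₂
    rw [hs₁] at hs₂
    refine (Runs.mul (by decide) (by decide) (by decide) (by decide) (by decide)).mono
      (by rw [hs₂]) fun s₃ hs₃ hf₃ => ⟨?_, by rw [hs₃, hs₂]⟩
    rw [hf₃.regs 3 (by decide), hf₂.regs 3 (by decide), hs₁]

/-! ### Exhaustive search -/

/-- Register `14` receives the power of register `7` to register `5`. -/
def Prog.power : Prog :=
  .seq (.assign 14 (.const 1))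
    (.forLoop 15 5 (.seq (.mul 16 14 7 13) (.assign 14 (.reg 16))))

theorem Runs.power (s : State) :
    Runs .power s (s.regs 5 * (s.regs 7 * 12 + 18) + 8)
      (fun s' => s'.regs 14 = s.regs 7 ^ s.regs 5) := by
  refine Runs.assign_seq (T₂ := s.regs 5 * (s.regs 7 * 12 + 18) + 6) ?_
    (by simp [Expr.cost]; omega)
  refine Runs.forLoop (T := s.regs 7 * 12 + 10) (N := s.regs 5)
    (fun j s' => s'.regs 14 = s.regs 7 ^ j)
    (by decide) (by decide) (by decide) (by simp) (by simp [Expr.eval]) ?_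
  intro j hj s₁ hs₁ _ hf
  have h₇ : s₁.regs 7 = s.regs 7 := hf.regs 7 (by decide)
  refine Runs.seq (T₁ := s.regs 7 * 12 + 8) (T₂ := 2)
    ((Runs.mul (by decide) (by decide) (by decide) (by decide) (by decide)).mono
      (by rw [h₇]) fun s' h _ => h) ?_ (by omega)
  intro s₂ hs₂ _
  refine Runs.assign ?_ (by simp [Expr.cost])
  intro _
  simp [Expr.eval, hs₂, hs₁, h₇, pow_succ]

/-- The digits of register `8` in base register `7` are decoded into entries of array `4`, which
are written into array `6`. -/
def Prog.decode : Prog :=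
  .seq (.assign 9 (.reg 8)) (.forLoop 10 5 (.seq (.assign 11 (.const 0))
    (.seq (.loop (.sub (.add (.reg 9) (.const 1)) (.reg 7))
      (.seq (.assign 9 (.sub (.reg 9) (.reg 7))) (.assign 11 (.add (.reg 11) (.const 1)))))
      (.seq (.store 6 (.reg 10) (.load 4 (.reg 9))) (.assign 9 (.reg 11))))))

theorem Runs.decode {B : ℕ} (hB : s.regs 8 ≤ B) (hw : 0 < s.regs 7) :
    Runs .decode s (s.regs 5 * (B * 14 + 22) + 8) (fun s' => ∀ p < s.regs 5,
      s'.arrs 6 p = s.arrs 4 (s.regs 8 / s.regs 7 ^ p % s.regs 7)) := by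
  set w := s.regs 7 with hw₀
  set c := s.regs 8 with hc₀
  refine Runs.assign_seq (T₂ := s.regs 5 * (B * 14 + 22) + 6) ?_ (by simp [Expr.cost]; omega)
  refine (Runs.forLoop (T := B * 14 + 14) (N := s.regs 5) (fun j s' => s'.regs 9 = c / w ^ j ∧
    ∀ p < j, s'.arrs 6 p = s.arrs 4 (c / w ^ p % w))
    (by decide) (by decide) (by decide) (by simp) (by simp [Expr.eval, hc₀]) ?_).mono le_rfl
    fun s' h _ => h.2
  rintro j hj s₁ ⟨h₉, h₆⟩ hj₁ hf
  have r₇ : s₁.regs 7 = w := hf.regs 7 (by decide)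
  have hle : c / w ^ j ≤ B := (Nat.div_le_self _ _).trans hB
  refine Runs.assign_seq (T₂ := B * 14 + 12) ?_ (by simp [Expr.cost]; omega)
  -- Division with remainder by repeated subtraction: register `9` ends as the remainder, the next
  -- digit, and register `11` as the quotient.
  refine Runs.seq (T₁ := B * 14 + 6) (T₂ := 6) ((Runs.loop (T := 8) (N := B)
    (fun l s' => s'.regs 9 ≤ l ∧ s'.regs 7 = w ∧ s'.regs 9 + w * s'.regs 11 = c / w ^ j)
    (by simp [h₉, hle, r₇, Expr.eval]) ?_ ?_).mono (by simp [Expr.cost]) fun s' h _ => h) ?_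
    (by omega)
  · rintro l s₂ ⟨hl, hw₂, -⟩ he
    simp only [Expr.eval, hw₂] at he
    omega
  · rintro l s₂ ⟨hl, hw₂, heq⟩ he
    simp only [Expr.eval, hw₂] at he
    refine Runs.assign_seq (T₂ := 4) (Runs.assign ?_ (by simp [Expr.cost])) (by simp [Expr.cost])
    simp only [Expr.eval, setReg_regs]
    simp only [hw₂, mul_add, if_true, Nat.reduceEqDiff, if_false, true_and]
    omega
  · rintro s₂ ⟨he, l, -, hw₂, heq⟩ hf₂
    simp only [Expr.eval, hw₂] at he
    have hlt : s₂.regs 9 < w := by omega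
    have hmod : s₂.regs 9 = c / w ^ j % w := by
      rw [← heq, Nat.add_mul_mod_self_left, Nat.mod_eq_of_lt hlt]
    have hdiv : s₂.regs 11 = c / w ^ (j + 1) := by
      rw [pow_succ, ← Nat.div_div_eq_div_mul, ← heq, Nat.add_mul_div_left _ _ hw,
        Nat.div_eq_of_lt hlt, zero_add]
    have r₁₀ : s₂.regs 10 = j := by rw [hf₂.regs 10 (by decide)]; simpa using hj₁
    have a₄ : s₂.arrs 4 = s.arrs 4 := by
      rw [hf₂.arrs 4 (by decide), setReg_arrs, hf.arrs 4 (by decide)]; rfl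
    have a₆ : s₂.arrs 6 = s₁.arrs 6 := hf₂.arrs 6 (by decide)
    refine Runs.store_seq (T₂ := 2) (Runs.assign ?_ (by simp [Expr.cost])) (by simp [Expr.cost])
    intro _
    refine ⟨by simp [Expr.eval, hdiv], fun p hp => ?_⟩
    simp only [Expr.eval, setReg_arrs, setArr_arrs_self, Function.update_apply, r₁₀, a₄, a₆, hmod]
    split_ifs with h
    · rw [h]
    · exact h₆ p (by omega)

/-- The entry of array `6` for the pair of colors in the registers `i` and `j`. -/
def Expr.rep (i j : ℕ) : Expr := .load 6 (.add (.load 5 (.reg i)) (.reg j))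

/-- Register `12` receives `0` if and only if array `6` contains a system of representatives; the
expression `e` tells whether the representatives of the colors in the registers `13` and `15`
have to be adjacent. -/
def Prog.check (e : Expr) : Prog :=
  .seq (.assign 12 (.const 0)) (.forLoop 13 1 (.forLoop 15 1 (.seq
    (.assign 12 (.add (.reg 12) (.sub (.add e (.sub (.const 1) (.adj (.rep 13 13) (.rep 13 15))))
      (.const 1))))
    (.forLoop 16 1 (.forLoop 18 1 (.assign 12 (.add (.reg 12) (.add
      (.sub (.add (.eq (.reg 15) (.reg 18)) (.adj (.rep 13 15) (.rep 16 18))) (.const 1))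
      (.sub (.add (.sub (.const 1) (.eq (.reg 15) (.reg 18))) (.eq (.rep 13 15) (.rep 16 18)))
        (.const 1))))))))))

/-- The running time of `Prog.check`. -/
def checkTime (k : ℕ) : ℕ := k * (k * (k * (k * 88 + 14) + 64) + 14) + 8

/-- For bits `a` and `b`, the truncated `a + b - 1` is their conjunction. Each violated clause thus
adds 1 to register `12`, which stays zero exactly if every clause holds. -/
theorem Runs.check {k : ℕ} {R : ℕ → ℕ → Prop} [DecidableRel R] {e : Expr} {x : ℕ → ℕ → ℕ}
    (he : ∀ s, e.eval s = if R (s.regs 13) (s.regs 15) then 1 else 0) (hec : e.cost ≤ 20)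
    (h : HoldsGraph H n s) (hk : s.regs 1 = k) (h₅ : ∀ i < k, s.arrs 5 i = i * k)
    (hx : ∀ i < k, ∀ j < k, s.arrs 6 (i * k + j) = x i j) (hxn : ∀ i < k, ∀ j < k, x i j < n) :
    Runs (.check e) s (checkTime k) (fun s' => s'.regs 12 = 0 ↔ IsSystem H k R x) := by
  -- Evaluation of representatives and adjacencies in any state that agrees with `s` on the relevant
  -- register and arrays, so that it can be used inside all four loops.
  have hgen : ∀ s' : State, s'.regs 0 = s.regs 0 → s'.arrs 0 = s.arrs 0 → s'.arrs 1 = s.arrs 1 →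
      s'.arrs 5 = s.arrs 5 → s'.arrs 6 = s.arrs 6 →
      (∀ i j, s'.regs i < k → s'.regs j < k →
        (Expr.rep i j).eval s' = x (s'.regs i) (s'.regs j)) ∧
      ∀ i j i' j', s'.regs i < k → s'.regs j < k → s'.regs i' < k → s'.regs j' < k →
        (Expr.adj (.rep i j) (.rep i' j')).eval s' =
          if H.Adj (x (s'.regs i) (s'.regs j)) (x (s'.regs i') (s'.regs j')) then 1 else 0 := by
    intro s' r₀ a₀ a₁ a₅ a₆
    have h₁ : ∀ i j, s'.regs i < k → s'.regs j < k →
        (Expr.rep i j).eval s' = x (s'.regs i) (s'.regs j) := by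
      intro i j hi hj
      simp only [Expr.rep, Expr.eval, a₅, a₆, h₅ _ hi, hx _ hi _ hj]
    refine ⟨h₁, fun i j i' j' hi hj hi' hj' => ?_⟩
    have := (h.of_eq r₀ a₀ a₁).eval_adj (e₁ := .rep i j) (e₂ := .rep i' j')
      (by rw [h₁ _ _ hi hj]; exact hxn _ hi _ hj) (by rw [h₁ _ _ hi' hj']; exact hxn _ hi' _ hj')
    rwa [h₁ _ _ hi hj, h₁ _ _ hi' hj'] at this
  refine Runs.assign_seq (T₂ := k * (k * (k * (k * 88 + 14) + 64) + 14) + 6) ?_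
    (by simp [Expr.cost, checkTime]; omega)
  refine (Runs.checkLoop (c := 12) (N := k) (T := k * (k * (k * 88 + 14) + 64) + 6)
    (fun i => ∀ j < k, (R i j → H.Adj (x i i) (x i j)) ∧ ∀ i' < k, ∀ j' < k,
      (j = j' → ¬ H.Adj (x i j) (x i' j')) ∧ (j ≠ j' → x i j ≠ x i' j'))
    (by simp [Prog.regsOut, Prog.forLoop]) (by simp [Prog.regsOut, Prog.forLoop]) (by decide)
    (by decide) (by simp [hk]) ?_).mono le_rfl ?_
  swap
  · intro s' hs' _
    rw [hs']
    simp only [Expr.eval, setReg_regs, if_true, true_and]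
    constructor
    · intro hall
      exact ⟨fun i hi j hj => (hall i hi j hj).1,
        fun i hi i' hi' j hj => ((hall i hi j hj).2 i' hi' j hj).1 rfl,
        fun i hi i' hi' j hj j' hj' => ((hall i hi j hj).2 i' hi' j' hj').2⟩
    · intro hsys i hi j hj
      refine ⟨hsys.adj i hi j hj, fun i' hi' j' hj' => ⟨?_, hsys.ne i hi i' hi' j hj j' hj'⟩⟩
      rintro rfl
      exact hsys.not_adj i hi i' hi' j hj
  intro i hi s₁ hi₁ hf₁
  have hs₁ : s₁.regs 0 = s.regs 0 ∧ s₁.regs 1 = s.regs 1 := by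
    constructor <;> refine hf₁.regs _ ?_ <;> simp [Prog.regsOut, Prog.forLoop]
  have ha₁ : s₁.arrs = s.arrs := by
    funext a; exact hf₁.arrs a (by simp [Prog.arrsOut, Prog.forLoop])
  refine Runs.checkLoop (c := 12) (N := k) (T := k * (k * 88 + 14) + 56)
    (fun j => (R i j → H.Adj (x i i) (x i j)) ∧ ∀ i' < k, ∀ j' < k,
      (j = j' → ¬ H.Adj (x i j) (x i' j')) ∧ (j ≠ j' → x i j ≠ x i' j'))
    (by simp [Prog.regsOut, Prog.forLoop]) (by simp [Prog.regsOut, Prog.forLoop]) (by decide)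
    (by decide) (by simp [hk, hs₁]) ?_
  intro j hj s₂ hj₂ hf₂
  have hs₂ : s₂.regs 0 = s₁.regs 0 ∧ s₂.regs 1 = s₁.regs 1 ∧ s₂.regs 13 = s₁.regs 13 := by
    refine ⟨?_, ?_, ?_⟩ <;> refine hf₂.regs _ ?_ <;> simp [Prog.regsOut, Prog.forLoop]
  have ha₂ : s₂.arrs = s₁.arrs := by
    funext a; exact hf₂.arrs a (by simp [Prog.arrsOut, Prog.forLoop])
  have hi₂ : s₂.regs 13 = i := by rw [hs₂.2.2, hi₁]
  have hg₂ := hgen s₂ (by rw [hs₂.1, hs₁.1]) (by rw [ha₂, ha₁]) (by rw [ha₂, ha₁])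
    (by rw [ha₂, ha₁]) (by rw [ha₂, ha₁])
  refine Runs.assign_seq (T₂ := k * (k * 88 + 14) + 6) ?_
    (by simp [Expr.cost, Expr.adj, Expr.rep]; omega)
  set s₃ := s₂.setReg 12 (Expr.eval s₂ (.add (.reg 12)
    (.sub (.add e (.sub (.const 1) (.adj (.rep 13 13) (.rep 13 15)))) (.const 1)))) with hs₃
  have h₃ : s₃.regs 12 = 0 ↔ s₂.regs 12 = 0 ∧ (R i j → H.Adj (x i i) (x i j)) := by
    have := hg₂.2 13 13 13 15 (by omega) (by omega) (by omega) (by omega)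
    rw [hi₂, hj₂] at this
    simp only [hs₃, setReg_regs, if_true, Expr.eval, he, this, hi₂, hj₂]
    by_cases hR : R i j <;> by_cases hA : H.Adj (x i i) (x i j) <;> simp [hR, hA]
  refine (Runs.checkLoop (c := 12) (N := k) (T := k * 88 + 6)
    (fun i' => ∀ j' < k, (j = j' → ¬ H.Adj (x i j) (x i' j')) ∧ (j ≠ j' → x i j ≠ x i' j'))
    (by simp [Prog.regsOut, Prog.forLoop]) (by simp [Prog.regsOut, Prog.forLoop]) (by decide)
    (by decide) (by simp [hs₃, hk, hs₁, hs₂]) ?_).mono le_rfl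
    fun s' hs' _ => by rw [hs', h₃, and_assoc]
  intro i' hi' s₄ hi₄ hf₄
  refine Runs.checkLoop (c := 12) (N := k) (T := 80)
    (fun j' => (j = j' → ¬ H.Adj (x i j) (x i' j')) ∧ (j ≠ j' → x i j ≠ x i' j'))
    (by simp [Prog.regsOut]) (by simp [Prog.regsOut]) (by decide)
    (by decide) (by rw [hf₄.regs 1 (by decide)]; simp [hs₃, hk, hs₁, hs₂]) ?_
  intro j' hj' s₅ hj₅ hf₅
  have hi₅ : s₅.regs 13 = i := by
    rw [hf₅.regs 13 (by decide), hf₄.regs 13 (by decide)]; simpa [hs₃] using hi₂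
  have hj'₅ : s₅.regs 15 = j := by
    rw [hf₅.regs 15 (by decide), hf₄.regs 15 (by decide)]; simpa [hs₃] using hj₂
  have hi'₅ : s₅.regs 16 = i' := by rw [hf₅.regs 16 (by decide), hi₄]
  have ha₅ : ∀ a, s₅.arrs a = s.arrs a := by
    intro a
    rw [hf₅.arrs a (by simp [Prog.arrsOut, Prog.forLoop]),
      hf₄.arrs a (by simp [Prog.arrsOut, Prog.forLoop]), hs₃, setReg_arrs, ha₂, ha₁]
  have hg₅ := hgen s₅ (by rw [hf₅.regs 0 (by decide), hf₄.regs 0 (by decide)]; simp [hs₃, hs₁, hs₂])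
    (ha₅ _) (ha₅ _) (ha₅ _) (ha₅ _)
  refine Runs.assign ?_ (by simp [Expr.cost, Expr.adj, Expr.eq, Expr.rep])
  have e₁ := hg₅.1 13 15 (by omega) (by omega)
  have e₂ := hg₅.1 16 18 (by omega) (by omega)
  have e₃ := hg₅.2 13 15 16 18 (by omega) (by omega) (by omega) (by omega)
  simp only [hi₅, hj'₅, hi'₅, hj₅] at e₁ e₂ e₃
  simp only [setReg_regs, if_true, Expr.eval, eval_eq, e₁, e₂, e₃, hj'₅, hj₅]
  by_cases hA : H.Adj (x i j) (x i' j') <;> by_cases hE : x i j = x i' j' <;>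
    by_cases hjj : j = j' <;> simp_all

end RAM

/-- Every sequence of `m` digits in base `w` is the expansion of a number below `w ^ m`. -/
theorem exists_lt_pow_forall_digit {w : ℕ} (m : ℕ) (d : ℕ → ℕ) (hd : ∀ p < m, d p < w) :
    ∃ c < w ^ m, ∀ p < m, c / w ^ p % w = d p := by
  induction m generalizing d with
  | zero => exact ⟨0, by simp, by simp⟩
  | succ m ih =>
    obtain ⟨c, hc, hcd⟩ := ih (fun p => d (p + 1)) fun p hp => hd (p + 1) (by omega)
    have h₀ := hd 0 (by omega)
    refine ⟨d 0 + w * c, ?_, fun p hp => ?_⟩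
    · rw [pow_succ]
      nlinarith
    · cases p with
      | zero => simp [Nat.mod_eq_of_lt h₀]
      | succ p =>
        rw [pow_succ', ← Nat.div_div_eq_div_mul, Nat.add_mul_div_left _ _ (by omega),
          Nat.div_eq_of_lt h₀, zero_add]
        exact hcd p (by omega)

namespace RAM

variable {H : SimpleGraph ℕ} [DecidableRel H.Adj] {n : ℕ} {s : State}

/-- Search a system of representatives in the list of length register `7` in array `4`; register
`0` receives `1` if there is one and `0` otherwise. -/
def Prog.search (e : Expr) : Prog :=
  .seq (.offsets 5 1 8 9) (.seq .power (.seq (.assign 17 (.const 0))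
    (.seq (.forLoop 8 14 (.seq .decode (.seq (.check e)
      (.branch (.reg 12) .skip (.assign 17 (.const 1)))))) (.assign 0 (.reg 17)))))

/-- The running time of `Prog.search`. -/
def searchTime (k w : ℕ) : ℕ :=
  w ^ (k * k) * (k * k * (w ^ (k * k) * 14 + 22) + checkTime k + 20) +
    k * k * (w * 12 + 18) + k * 15 + 26

theorem searchTime_mono (k : ℕ) {w w' : ℕ} (h : w ≤ w') : searchTime k w ≤ searchTime k w' := by
  unfold searchTime
  gcongr

/-- Filling `k * k` cells from a list of length `w` amounts to choosing `k * k` digits in base `w`,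
with cell `(i, j)` at digit `i * k + j`. For an empty list the bound `w ^ (k * k)` is zero, as `k`
is positive, and the loop is never entered. The answer waits in register `17` because register `0`
still holds `n`. -/
theorem Runs.search {k : ℕ} (hk₀ : 0 < k) {R : ℕ → ℕ → Prop} [DecidableRel R] {e : Expr}
    (he : ∀ s, e.eval s = if R (s.regs 13) (s.regs 15) then 1 else 0) (hec : e.cost ≤ 20)
    (h : HoldsGraph H n s) (hk : s.regs 1 = k) (h₅ : s.regs 5 = k * k)
    (hW : ∀ y ∈ listOf (s.arrs 4) (s.regs 7), y < n) :
    Runs (.search e) s (searchTime k (s.regs 7)) (fun s' => s'.regs 0 ≤ 1 ∧ (s'.regs 0 = 1 ↔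
      ∃ x, IsSystem H k R x ∧ ∀ i < k, ∀ j < k, x i j ∈ listOf (s.arrs 4) (s.regs 7))) := by
  set w := s.regs 7 with hw
  set f := s.arrs 4 with hf
  set B := w ^ (k * k) with hB
  set T := B * (k * k * (B * 14 + 22) + checkTime k + 20) with hT
  let x : ℕ → ℕ → ℕ → ℕ := fun c i j => f (c / w ^ (i * k + j) % w)
  have hij : ∀ i < k, ∀ j < k, i * k + j < k * k := fun i hi j hj =>
    calc i * k + j < i * k + k := by omega
      _ = (i + 1) * k := by ring
      _ ≤ k * k := Nat.mul_le_mul_right _ hi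
  have hxW : ∀ c < B, ∀ i j, x c i j ∈ listOf f w := by
    intro c hc i j
    have hw₀ : 0 < w := by
      rcases Nat.eq_zero_or_pos w with h₀ | h₀
      · rw [hB, h₀, zero_pow (by positivity)] at hc
        omega
      · exact h₀
    exact List.mem_map_of_mem (List.mem_range.2 (Nat.mod_lt _ hw₀))
  refine Runs.seq (T₁ := k * 15 + 8) (T₂ := T + k * k * (w * 12 + 18) + 18)
    ((Runs.offsets (by decide) (by decide) (by decide)).mono (by rw [hk]) fun s' h _ => h) ?_
    (by change _ ≤ T + k * k * (w * 12 + 18) + k * 15 + 26; omega)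
  intro s₁ o₁ f₁
  rw [hk] at o₁
  refine Runs.seq (T₁ := k * k * (w * 12 + 18) + 8) (T₂ := T + 10)
    ((Runs.power s₁).mono (by rw [f₁.regs 5 (by decide), f₁.regs 7 (by decide), h₅])
      fun s' h _ => h) ?_ (by omega)
  intro s₂ p₂ f₂
  rw [f₁.regs 5 (by decide), f₁.regs 7 (by decide), h₅] at p₂
  refine Runs.assign_seq (T₂ := T + 8) ?_ (by simp [Expr.cost]; omega)
  refine Runs.seq (T₁ := T + 6) (T₂ := 2)
    (Runs.forLoop (T := k * k * (B * 14 + 22) + checkTime k + 12) (N := B) (fun j s' =>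
      s'.regs 17 ≤ 1 ∧ (s'.regs 17 = 1 ↔ ∃ c < j, IsSystem H k R (x c)))
    (by simp [Prog.regsOut, Prog.decode, Prog.check, Prog.forLoop])
    (by simp [Prog.regsOut, Prog.decode, Prog.check, Prog.forLoop]) (by decide)
    (by simpa using p₂) (by simp [Expr.eval]) ?_) ?_ le_rfl
  · rintro c hc s₃ ⟨l₃, i₃⟩ hc₃ f₃
    have hreg : ∀ r ∈ [0, 1, 5, 7], s₃.regs r = s.regs r := by
      intro r hr
      simp only [List.mem_cons, List.not_mem_nil, or_false] at hr
      rw [f₃.regs r (by rcases hr with rfl | rfl | rfl | rfl <;>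
        simp [Prog.regsOut, Prog.decode, Prog.check, Prog.forLoop]), setReg_regs,
        if_neg (by omega), f₂.regs r (by rcases hr with rfl | rfl | rfl | rfl <;> decide),
        f₁.regs r (by rcases hr with rfl | rfl | rfl | rfl <;> decide)]
    have harr : ∀ a ∈ [0, 1, 4], s₃.arrs a = s.arrs a := by
      intro a ha
      simp only [List.mem_cons, List.not_mem_nil, or_false] at ha
      rw [f₃.arrs a (by rcases ha with rfl | rfl | rfl <;>
        simp [Prog.arrsOut, Prog.decode, Prog.check, Prog.forLoop]), setReg_arrs,
        f₂.arrs a (by rcases ha with rfl | rfl | rfl <;> decide),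
        f₁.arrs a (by rcases ha with rfl | rfl | rfl <;> decide)]
    have a₅ : s₃.arrs 5 = s₁.arrs 5 := by
      rw [f₃.arrs 5 (by simp [Prog.arrsOut, Prog.decode, Prog.check, Prog.forLoop]), setReg_arrs,
        f₂.arrs 5 (by decide)]
    have hg₃ : HoldsGraph H n s₃ := h.of_eq (hreg 0 (by simp)) (harr 0 (by simp)) (harr 1 (by simp))
    have r₁ : s₃.regs 1 = k := by rw [hreg 1 (by simp), hk]
    have r₅ : s₃.regs 5 = k * k := by rw [hreg 5 (by simp), h₅]
    have r₇ : s₃.regs 7 = w := hreg 7 (by simp)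
    have hw₀ : 0 < w := by
      have := List.length_pos_of_mem (hxW c hc 0 0)
      simpa using this
    refine Runs.seq (T₁ := k * k * (B * 14 + 22) + 8) (T₂ := checkTime k + 4)
      ((Runs.decode (B := B) (by omega) (by omega)).mono (by rw [r₅]) fun s' h _ => h) ?_ (by omega)
    intro s₄ d₄ f₄
    rw [r₅, r₇, hc₃, harr 4 (by simp)] at d₄
    refine Runs.seq (Runs.check (x := x c) he hec (hg₃.frame f₄ (by decide) (by decide))
      (by rw [f₄.regs 1 (by decide), r₁])
      (fun i hi => by rw [f₄.arrs 5 (by decide), a₅, o₁ i hi])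
      (fun i hi j hj => d₄ _ (hij i hi j hj)) (fun i hi j hj => hW _ (hxW c hc i j)))
      (T₂ := 4) ?_ le_rfl
    intro s₅ c₅ f₅
    have r₁₇ : s₅.regs 17 = s₃.regs 17 := by
      rw [f₅.regs 17 (by simp [Prog.regsOut, Prog.check, Prog.forLoop]), f₄.regs 17 (by decide)]
    have hsucc : (∃ c' < c + 1, IsSystem H k R (x c')) ↔
        (∃ c' < c, IsSystem H k R (x c')) ∨ IsSystem H k R (x c) := by
      constructor
      · rintro ⟨c', hc', h'⟩
        rcases Nat.lt_succ_iff_lt_or_eq.1 hc' with hc' | rfl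
        · exact Or.inl ⟨c', hc', h'⟩
        · exact Or.inr h'
      · rintro (⟨c', hc', h'⟩ | h')
        · exact ⟨c', by omega, h'⟩
        · exact ⟨c, by omega, h'⟩
    refine Runs.branch (T₁ := 2) (fun hne => Runs.skip ?_ (by omega))
      (fun h0 => Runs.assign ?_ (by simp [Expr.cost])) (by simp [Expr.cost])
    · intro _
      have hno : ¬ IsSystem H k R (x c) := fun h' => hne (c₅.2 h')
      simp only [setReg_regs, show (17 : ℕ) ≠ 8 by decide, if_false, r₁₇, hsucc, hno, or_false]
      exact ⟨l₃, i₃⟩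
    · intro _
      have hyes : IsSystem H k R (x c) := c₅.1 h0
      rw [hsucc]
      simp [hyes, Expr.eval]
  · rintro s₃ ⟨l₃, i₃⟩ -
    refine Runs.assign ?_ (by simp [Expr.cost])
    simp only [Expr.eval, setReg_regs, if_true]
    refine ⟨l₃, i₃.trans ⟨?_, ?_⟩⟩
    · rintro ⟨c, hc, hsys⟩
      exact ⟨x c, hsys, fun i _ j _ => hxW c hc i j⟩
    · rintro ⟨y, hy, hyW⟩
      -- Positions in the list of the entries of the given system; they are the digits of the number
      -- at which the search finds it.
      have hd : ∀ p : ℕ, ∃ d, p < k * k → d < w ∧ f d = y (p / k) (p % k) := by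
        intro p
        by_cases hp : p < k * k
        · have := hyW (p / k) (Nat.div_lt_of_lt_mul hp) (p % k) (Nat.mod_lt _ hk₀)
          obtain ⟨d, hd, hd'⟩ := List.mem_map.1 this
          exact ⟨d, fun _ => ⟨List.mem_range.1 hd, hd'⟩⟩
        · exact ⟨0, fun h => absurd h hp⟩
      choose d hd using hd
      obtain ⟨c, hc, hcd⟩ := exists_lt_pow_forall_digit (k * k) d fun p hp => (hd p hp).1
      refine ⟨c, hc, hy.congr fun i hi j hj => ?_⟩
      have hlt := hij i hi j hj
      simp only [x]
      rw [hcd _ hlt, (hd _ hlt).2, mul_comm, Nat.mul_add_div hk₀, Nat.div_eq_of_lt hj,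
        Nat.mul_add_mod, Nat.mod_eq_of_lt hj, add_zero]

end RAM

/-! ### The algorithm -/

section Transfer

variable {n : ℕ} (G : SimpleGraph (Fin n))

/-- The graph `G` as a graph on the natural numbers. -/
abbrev natGraph : SimpleGraph ℕ := G.map Fin.valEmbedding

variable {G}

theorem natGraph_adj {u v : ℕ} (hu : u < n) (hv : v < n) :
    (natGraph G).Adj u v ↔ G.Adj ⟨u, hu⟩ ⟨v, hv⟩ :=
  SimpleGraph.map_adj_apply (f := Fin.valEmbedding) (a := ⟨u, hu⟩) (b := ⟨v, hv⟩)

theorem lt_of_natGraph_adj {u v : ℕ} (h : (natGraph G).Adj u v) : u < n ∧ v < n := by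
  obtain ⟨a, b, -, rfl, rfl⟩ := (SimpleGraph.map_adj _ _ _ _).1 h
  exact ⟨a.2, b.2⟩

theorem exists_isSystem_natGraph_iff {k : ℕ} (hk : 0 < k) {R : ℕ → ℕ → Prop} :
    (∃ x, IsSystem G k R x) ↔
      ∃ x, IsSystem (natGraph G) k R x ∧ ∀ i < k, ∀ j < k, x i j < n := by
  constructor
  · rintro ⟨x, hx⟩
    refine ⟨fun i j => x i j, ⟨?_, ?_, ?_⟩, fun i _ j _ => (x i j).2⟩
    · intro i hi j hj hR
      exact (natGraph_adj (x i i).2 (x i j).2).2 (hx.adj i hi j hj hR)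
    · intro i hi i' hi' j hj h
      exact hx.not_adj i hi i' hi' j hj ((natGraph_adj (x i j).2 (x i' j).2).1 h)
    · intro i hi i' hi' j hj j' hj' hne h
      exact hx.ne i hi i' hi' j hj j' hj' hne (Fin.ext h)
  · rintro ⟨x, hx, hxn⟩
    have hn : 0 < n := (Nat.zero_le _).trans_lt (hxn 0 hk 0 hk)
    -- Cells outside the `k` by `k` square may hold numbers that are not vertices; reduction modulo
    -- `n` repairs them and leaves the others unchanged.
    have hmod : ∀ i < k, ∀ j < k, x i j % n = x i j := fun i hi j hj =>
      Nat.mod_eq_of_lt (hxn i hi j hj)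
    have hx' := hx.congr fun i hi j hj => (hmod i hi j hj).symm
    refine ⟨fun i j => ⟨x i j % n, Nat.mod_lt _ hn⟩, ⟨?_, ?_, ?_⟩⟩
    · intro i hi j hj hR
      exact (natGraph_adj _ _).1 (hx'.adj i hi j hj hR)
    · intro i hi i' hi' j hj h
      exact hx'.not_adj i hi i' hi' j hj ((natGraph_adj _ _).2 h)
    · intro i hi i' hi' j hj j' hj' hne h
      exact hx'.ne i hi i' hi' j hj j' hj' hne (congrArg Fin.val h)

theorem length_nbrs_natGraph [DecidableRel G.Adj] [DecidableRel (natGraph G).Adj] (v : Fin n) :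
    (nbrs (natGraph G) n v).length = G.degree v := by
  unfold nbrs
  rw [← List.toFinset_card_of_nodup (List.nodup_range.filter _), ← G.card_neighborFinset_eq_degree,
    ← Finset.card_map Fin.valEmbedding]
  congr 1
  ext w
  simp only [List.mem_toFinset, List.mem_filter, List.mem_range, decide_eq_true_eq,
    Finset.mem_map, SimpleGraph.mem_neighborFinset]
  constructor
  · rintro ⟨hw, h⟩
    exact ⟨⟨w, hw⟩, (natGraph_adj v.2 hw).1 h, rfl⟩
  · rintro ⟨w, h, rfl⟩
    exact ⟨w.2, (natGraph_adj v.2 w.2).2 h⟩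

theorem length_highs_natGraph [DecidableRel G.Adj] [DecidableRel (natGraph G).Adj] (M : ℕ) :
    (highs (natGraph G) n M).length = (Finset.univ.filter fun v => M ≤ G.degree v).card := by
  unfold highs
  rw [← List.toFinset_card_of_nodup (List.nodup_range.filter _), ← Finset.card_map Fin.valEmbedding]
  congr 1
  ext v
  simp only [List.mem_toFinset, List.mem_filter, List.mem_range, decide_eq_true_eq,
    Finset.mem_map, Finset.mem_filter, Finset.mem_univ, true_and]
  constructor
  · rintro ⟨hv, h⟩
    exact ⟨⟨v, hv⟩, by rwa [← length_nbrs_natGraph], rfl⟩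
  · rintro ⟨v, h, rfl⟩
    exact ⟨v.2, by simpa [length_nbrs_natGraph] using h⟩

end Transfer

/-! ### The complete program and its correctness -/

namespace RAM

/-- Decide whether the graph has a system of representatives; the expression `e` tells
whether the representatives of the colors in the registers `13` and `15` have to be adjacent. -/
def Prog.solve (e : Expr) : Prog :=
  .seq (.offsets 1 0 8 9) (.seq (.mul 5 1 1 8) (.seq .thresholds (.seq .highs
    (.branch (.sub (.reg 3) (.reg 6)) (.seq .mark (.search e)) (.assign 0 (.const 1))))))

/-- The parameter-dependent factor of the running time of `Prog.solve`. -/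
def solveFactor (k t : ℕ) : ℕ :=
  let M := threshold k t
  let d := M + M
  d * (d * 58 + 14) + d * 16 + searchTime k (listBound M (M * M * (M * M))) +
    thresholdsTime k M + k * 12 + 200

theorem inputState_entry {n : ℕ} (G : SimpleGraph (Fin n)) [DecidableRel (natGraph G).Adj]
    (k t : ℕ) {u v : ℕ} (hu : u < n) (hv : v < n) :
    (inputState G k t).arrs 0 (u * n + v) = if (natGraph G).Adj u v then 1 else 0 := by
  have key : (∃ i j : Fin n, u * n + v = (i : ℕ) * n + (j : ℕ) ∧ G.Adj i j) ↔
      (natGraph G).Adj u v := by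
    rw [natGraph_adj hu hv]
    constructor
    · rintro ⟨i, j, h, hadj⟩
      have hn : 0 < n := by omega
      have h₁ : u = i := by
        have := congrArg (· / n) h
        simpa [mul_comm _ n, Nat.mul_add_div hn, Nat.div_eq_of_lt hv,
          Nat.div_eq_of_lt j.2] using this
      have h₂ : v = j := by
        have := congrArg (· % n) h
        simpa [mul_comm _ n, Nat.mul_add_mod, Nat.mod_eq_of_lt hv, Nat.mod_eq_of_lt j.2] using this
      subst h₁ h₂
      exact hadj
    · intro h
      exact ⟨⟨u, hu⟩, ⟨v, hv⟩, rfl, h⟩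
  by_cases h : (natGraph G).Adj u v <;> simp [inputState, key, h]

theorem Runs.solve {k t n : ℕ} (G : SimpleGraph (Fin n)) (hk : 0 < k)
    (hG : (completeBipartiteGraph (Fin t) (Fin t)).Free G) {R : ℕ → ℕ → Prop} [DecidableRel R]
    (hR : ∀ i, ¬ R i i) {e : Expr}
    (he : ∀ s, e.eval s = if R (s.regs 13) (s.regs 15) then 1 else 0) (hec : e.cost ≤ 20) :
    Runs (.solve e) (inputState G k t) (solveFactor k t * max n 1 ^ 2)
      (fun s' => s'.regs 0 ≤ 1 ∧ (s'.regs 0 = 1 ↔ ∃ x, IsSystem G k R x)) := by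
  classical
  set s := inputState G k t with hs
  set M := threshold k t with hM
  set N := M * M * (M * M) with hN
  set d := M + M with hd
  set S := searchTime k (listBound M N) with hS
  set H := natGraph G with hH
  have r₀ : s.regs 0 = n := rfl
  have r₁ : s.regs 1 = k := rfl
  have r₂ : s.regs 2 = t := rfl
  have hkM : k * k < M := mul_self_lt_threshold k t
  have hHn : ∀ v w, H.Adj v w → v < n ∧ w < n := fun v w h => lt_of_natGraph_adj h
  -- Apart from the parameter-dependent terms, the total is `37 * n ^ 2 + 113 * n + 36`, so the
  -- constant 200 in `solveFactor` is ample.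
  have htime : n * 15 + 8 + (k * 12 + 8 + (thresholdsTime k M + (n * (n * 16 + 22 + 8) + 8 +
      (4 + (markTime n d + S))))) ≤ solveFactor k t * max n 1 ^ 2 := by
    have hm₁ : n ≤ max n 1 := le_max_left _ _
    have hm₂ : 1 ≤ max n 1 := le_max_right _ _
    generalize max n 1 = m at hm₁ hm₂
    have e₁ : n * n ≤ m ^ 2 := by nlinarith
    have e₂ : n ≤ m ^ 2 := by nlinarith
    have e₃ : 1 ≤ m ^ 2 := by nlinarith
    have e₄ : n * (d * (d * 58 + 14) + d * 16) ≤ m ^ 2 * (d * (d * 58 + 14) + d * 16) :=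
      Nat.mul_le_mul_right _ e₂
    have e₅ : 1 * (S + thresholdsTime k M + k * 12) ≤
        m ^ 2 * (S + thresholdsTime k M + k * 12) := Nat.mul_le_mul_right _ e₃
    have e₆ : solveFactor k t * m ^ 2 = m ^ 2 * (d * (d * 58 + 14) + d * 16) +
        m ^ 2 * (S + thresholdsTime k M + k * 12) + 200 * m ^ 2 := by
      simp only [solveFactor, ← hM, ← hN, ← hd, ← hS]
      ring
    have e₇ : markTime n d = 21 * (n * n) + n * (d * (d * 58 + 14) + d * 16) + 68 * n + 8 := by
      simp only [markTime]
      ring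
    have e₈ : n * (n * 16 + 22 + 8) = 16 * (n * n) + 30 * n := by ring
    omega
  refine Runs.seq (T₁ := n * 15 + 8)
    ((Runs.offsets (by decide) (by decide) (by decide)).mono (by rw [r₀]) fun s' h _ => h) ?_ htime
  intro s₁ o₁ f₁
  rw [r₀] at o₁
  have hg₁ : HoldsGraph H n s₁ := by
    refine ⟨f₁.regs 0 (by decide), o₁, fun u hu v hv => ?_⟩
    rw [f₁.arrs 0 (by decide)]
    exact inputState_entry G k t hu hv
  have r₁₁ : s₁.regs 1 = k := f₁.regs 1 (by decide)
  refine Runs.seq (T₁ := k * 12 + 8) ((Runs.mul (by decide) (by decide) (by decide) (by decide)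
    (by decide)).mono (by rw [r₁₁]) fun s' h _ => h) ?_ le_rfl
  intro s₂ m₂ f₂
  rw [r₁₁] at m₂
  refine Runs.seq (Runs.thresholds (k := k) (t := t) (by rw [f₂.regs 1 (by decide), r₁₁])
    (by rw [f₂.regs 2 (by decide), f₁.regs 2 (by decide), r₂]) m₂) ?_ le_rfl
  rintro s₃ ⟨t₃, t₄⟩ f₃
  rw [← hM] at t₃
  rw [← hM, ← hN] at t₄
  have hg₃ : HoldsGraph H n s₃ :=
    (hg₁.frame f₂ (by decide) (by decide)).frame f₃ (by decide) (by decide)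
  refine Runs.seq (Runs.highs hg₃) ?_ le_rfl
  rintro s₄ ⟨h₂, h₄⟩ f₄
  rw [t₃] at h₂ h₄
  have hg₄ : HoldsGraph H n s₄ := hg₃.frame f₄ (by decide) (by decide)
  have r₃ : s₄.regs 3 = M := by rw [f₄.regs 3 (by decide), t₃]
  have r₄ : s₄.regs 4 = N := by rw [f₄.regs 4 (by decide), t₄]
  have r₅ : s₄.regs 5 = k * k := by rw [f₄.regs 5 (by decide), f₃.regs 5 (by decide), m₂]
  have r₁₄ : s₄.regs 1 = k := by
    rw [f₄.regs 1 (by decide), f₃.regs 1 (by decide), f₂.regs 1 (by decide), r₁₁]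
  have r₆ : s₄.regs 6 = (_root_.highs H n M).length := by rw [← h₂, length_listOf]
  refine Runs.branch (T₁ := markTime n d + S) (fun hlt => ?_) (fun hge => ?_) (by simp [Expr.cost])
  · simp only [Expr.eval, r₃, r₆] at hlt
    have hlen : (_root_.highs H n M).length ≤ M := by omega
    -- The counters of the types need no initialization: array `3` is zero in the input state and
    -- has not been touched.
    have a₃ : s₄.arrs 3 = fun _ => 0 := by
      rw [f₄.arrs 3 (by decide), f₃.arrs 3 (by decide), f₂.arrs 3 (by decide),
        f₁.arrs 3 (by decide), hs]
      simp [inputState]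
    have hmark := Runs.mark hg₄ (A := _root_.highs H n M)
      (fun a ha => List.mem_range.1 (List.mem_filter.1 ha).1) h₂ h₄ a₃
    rw [r₃, r₄] at hmark
    refine Runs.seq (hmark.mono (T := markTime n d) ?_ fun s' h _ => h) (T₂ := S) ?_ le_rfl
    · have : (_root_.highs H n M).length + M ≤ d := by omega
      unfold markTime
      gcongr
    rintro s₅ ⟨Mk, hMk⟩ f₅
    have hw : s₅.regs 7 ≤ listBound M N := by simpa using hMk.length_le_listBound hlen
    refine (Runs.search hk he hec (hg₄.frame f₅ (by decide) (by decide))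
      (by rw [f₅.regs 1 (by decide), r₁₄]) (by rw [f₅.regs 5 (by decide), r₅]) hMk.lt).mono
      (searchTime_mono k hw) ?_
    rintro s₆ ⟨hle, hiff⟩ -
    refine ⟨hle, hiff.trans ?_⟩
    rw [exists_isSystem_natGraph_iff hk]
    constructor
    · rintro ⟨x, hx, hxW⟩
      exact ⟨x, hx, fun i hi j hj => hMk.lt _ (hxW i hi j hj)⟩
    · rintro ⟨x, hx, hxn⟩
      refine hMk.exists_isSystem hHn (by omega) ?_ hx hxn
      -- The fourth power of `M` exceeds `k * k * (M * M)`, the number of forbidden targets, because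
      -- `k * k < M ≤ M * M`.
      exact Nat.mul_lt_mul_of_pos_right (hkM.trans_le (Nat.le_mul_self M))
        (Nat.mul_pos (by omega) (by omega))
  · simp only [Expr.eval, r₃, r₆] at hge
    -- At least `M` vertices have degree at least `M`, so the constant answer 1 is correct.
    have hex : ∃ x, IsSystem G k R x := by
      refine exists_isSystem_of_threshold_le_card hG R hR ?_
      rw [← length_highs_natGraph]
      exact Nat.le_of_sub_eq_zero hge
    refine Runs.assign ?_ (by simp [Expr.cost, markTime]; omega)
    simp [Expr.eval, hex]

theorem Runs.decidesInTime {p : Prog} {s : State} {T : ℕ} {A : Prop}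
    (h : Runs p s T fun s' => s'.regs 0 ≤ 1 ∧ (s'.regs 0 = 1 ↔ A)) : DecidesInTime p s A T := by
  obtain ⟨s', T', he, hT, hle, hiff⟩ := h
  refine ⟨s', T', he, hT, ?_⟩
  split_ifs with hA
  · exact hiff.2 hA
  · have : s'.regs 0 ≠ 1 := fun h => hA (hiff.1 h)
    omega

end RAM

theorem mainTheorem5 :
    (∃ (h : ℕ → ℕ → ℕ) (c : ℕ) (P : RAM.Prog),
      ∀ (k t n : ℕ) (G : SimpleGraph (Fin n)), 0 < k →
        (completeBipartiteGraph (Fin t) (Fin t)).Free G →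
        RAM.DecidesInTime P (RAM.inputState G k t) (BChromaticCoreProblem G k)
          (h k t * max n 1 ^ c)) ∧
    (∃ (h : ℕ → ℕ → ℕ) (c : ℕ) (P : RAM.Prog),
      ∀ (k t n : ℕ) (G : SimpleGraph (Fin n)), 0 < k →
        (completeBipartiteGraph (Fin t) (Fin t)).Free G →
        RAM.DecidesInTime P (RAM.inputState G k t) (PartialGrundyColoringProblem G k)
          (h k t * max n 1 ^ c)) := by
  constructor
  -- Registers `13` and `15` hold the colors `i` and `j` during the check; the expression is the
  -- indicator of `j ≠ i`.
  · refine ⟨RAM.solveFactor, 2, .solve (.sub (.const 1) (.eq (.reg 15) (.reg 13))), ?_⟩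
    intro k t n G hk hG
    rw [bChromaticCoreProblem_iff G hk]
    refine (RAM.Runs.solve G hk hG (by simp) (fun s => ?_)
      (by simp [RAM.Expr.cost, RAM.Expr.eq])).decidesInTime
    simp only [RAM.Expr.eval, RAM.eval_eq]
    split_ifs <;> simp_all
  -- The double truncated complement turns any positive difference `i - j` into 1, which gives the
  -- indicator of `j < i`.
  · refine ⟨RAM.solveFactor, 2,
      .solve (.sub (.const 1) (.sub (.const 1) (.sub (.reg 13) (.reg 15)))), ?_⟩
    intro k t n G hk hG
    rw [partialGrundyColoringProblem_iff G hk]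
    refine (RAM.Runs.solve G hk hG (by simp) (fun s => ?_)
      (by simp [RAM.Expr.cost])).decidesInTime
    simp only [RAM.Expr.eval]
    split_ifs <;> omega
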